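/- Consider a stochastic bandit problem with $K\ge 1$ arms and horizon $T\ge 1$. An environment is a family of probability laws $f_t^k$ on $\mathbb R$ ($1\le t\le T$, $1\le k\le K$); when arm $k$ is selected in slot $t$, a reward with law $f_t^k$ is received, drawn independently of the past. Let $\mu_t^k$ be the mean of $f_t^k$. Fix $b>0$. For $a\in\mathbb R$ and $V_T>0$ let $\mathcal E(V_T,T,K)$ be the set of environments such that, for all $t,k$, $\int e^{\lambda(x-\mu_t^k)}\,f_t^k(dx)\le e^{\lambda^2/8}$ for all $\lambda\in\mathbb R$ and $\mu_t^k\in[a,a+b]$, and such that $\sum_{t=1}^{T-1}\max_k|\mu_{t+1}^k-\mu_t^k|\le V_T$. A policy $\rho$ selects the arm $\varphi_t$, possibly at random, on the basis of the arms selected and the rewards received before slot $t$; its regret in an environment is $$R_T^\rho=\sum_{t=1}^T\max_k\mu_t^k-\mathbb E\Big[\sum_{t=1}^T X_t^{\varphi_t}\Big],$$ where $X_t^{\varphi_t}$ is the reward received in slot $t$. Put $\tau=\lceil K^{1/3}(T/V_T)^{2/3}\rceil$. Resetting MOSS (R-MOSS) cuts the horizon into consecutive epochs of $\tau$ slots (the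 last one possibly shorter) and uses only observations from the current epoch: in each epoch it first selects each arm once, in any order, and then in every slot selects an arm $k$ that maximizes $$\hat\mu_k+\sqrt{\frac{\max\big(\ln(\tau/(K n_k)),0\big)}{n_k}},$$ where $n_k$ and $\hat\mu_k$ are the number of samples and the empirical mean of arm $k$ in the current epoch; ties are broken in any way. Then there are constants $C,c>0$ that depend only on $b$ such that the following holds. 1. For all $a\in\mathbb R$, $K,T\ge 1$ and $V_T>0$ with $\tau\le T$, $$\sup_{\mathcal E(V_T,T,K)}R_T^{\text{R-MOSS}}\le C\,(KV_T)^{1/3}T^{2/3}.$$ 2. This order is optimal: for all $a\in\mathbb R$, $K\ge 2$, $T\ge 1$ and $V_T\in[1/K,T/K]$, $$\inf_\rho\ \sup_{\mathcal E(V_T,T,K)}R_T^\rho\ \ge\ c\,(KV_T)^{1/3}T^{2/3},$$ where the infimum is over all policies. -/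

import Mathlib

open MeasureTheory ProbabilityTheory

namespace Bandit

noncomputable section

/-- An environment with `K` arms: `E t k` is the law of the reward of arm `k` in time slot `t`.
Slots are numbered from `0`; for a horizon `T` only the slots `0, …, T - 1` are ever used. -/
abbrev Environment (K : ℕ) := ℕ → Fin K → ProbabilityMeasure ℝ

/-- The observations (selected arm, received reward) of the slots `0, …, n - 1`. -/
abbrev History (K n : ℕ) := Fin n → Fin K × ℝ

/-- A (possibly randomized) policy: for each slot `n`, the conditional law of the arm selected
in slot `n` given the observations of the earlier slots. -/
structure Policy (K : ℕ) where
  /-- the conditional law of the selected arm -/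
  select : (n : ℕ) → Kernel (History K n) (Fin K)
  /-- it is a probability measure -/
  markov : ∀ n, IsMarkovKernel (select n)

instance {K : ℕ} (ρ : Policy K) (n : ℕ) : IsMarkovKernel (ρ.select n) := ρ.markov n

/-- The mean reward of arm `k` in slot `t`. -/
def mean {K : ℕ} (E : Environment K) (t : ℕ) (k : Fin K) : ℝ :=
  ∫ x, x ∂(E t k : Measure ℝ)

/-- The largest mean reward in slot `t`. -/
def bestMean {K : ℕ} (E : Environment K) (t : ℕ) : ℝ := ⨆ k, mean E t k

/-- The total variation of the mean rewards over the horizon `T`. -/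
def variation {K : ℕ} (E : Environment K) (T : ℕ) : ℝ :=
  ∑ t ∈ Finset.range (T - 1), ⨆ k, |mean E (t + 1) k - mean E t k|

/-- Sub-Gaussian rewards: every centred reward `X` satisfies
`𝔼 exp (l * X) ≤ exp (l ^ 2 / 8)` for all real `l`, and every mean lies in `[a, a + b]`. -/
def IsSubGaussianEnv {K : ℕ} (E : Environment K) (a b : ℝ) (T : ℕ) : Prop :=
  ∀ t < T, ∀ k, HasSubgaussianMGF (fun x => x - mean E t k) (1 / 4) (E t k : Measure ℝ) ∧
    mean E t k ∈ Set.Icc a (a + b)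

/-- The sub-Gaussian environments with total variation at most `V`. -/
def envClass (K : ℕ) (a b : ℝ) (V : ℝ) (T : ℕ) : Set (Environment K) :=
  {E | IsSubGaussianEnv E a b T ∧ variation E T ≤ V}

/-- The law of the reward of slot `t` as a function of the selected arm. -/
def rewardKernel {K : ℕ} (E : Environment K) (t : ℕ) : Kernel (Fin K) ℝ :=
  Kernel.ofFunOfCountable fun k => (E t k : Measure ℝ)

instance {K : ℕ} (E : Environment K) (t : ℕ) : IsMarkovKernel (rewardKernel E t) :=
  ⟨fun k => inferInstanceAs (IsProbabilityMeasure (E t k : Measure ℝ))⟩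

/-- The conditional law of the observation of slot `n` given the earlier ones: the arm is drawn
from the policy, then the reward is drawn from the law of that arm, independently of the past. -/
def stepKernel {K : ℕ} (E : Environment K) (ρ : Policy K) (n : ℕ) :
    Kernel (History K n) (Fin K × ℝ) :=
  ρ.select n ⊗ₖ Kernel.prodMkLeft (History K n) (rewardKernel E n)

instance {K : ℕ} (E : Environment K) (ρ : Policy K) (n : ℕ) :
    IsMarkovKernel (stepKernel E ρ n) := by
  unfold stepKernel; infer_instance

/-- A history extended by one observation. -/
def extend {K n : ℕ} (p : History K n × (Fin K × ℝ)) : History K (n + 1) :=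
  Fin.snoc (α := fun _ => Fin K × ℝ) p.1 p.2

/-- The law of the first `n` observations when policy `ρ` is run in environment `E`. -/
def historyLaw {K : ℕ} (E : Environment K) (ρ : Policy K) : (n : ℕ) → Measure (History K n)
  | 0 => Measure.dirac Fin.elim0
  | n + 1 => (historyLaw E ρ n ⊗ₘ stepKernel E ρ n).map extend

theorem measurable_extend {K n : ℕ} : Measurable (extend (K := K) (n := n)) := by
  refine measurable_pi_lambda _ fun i => ?_
  refine Fin.lastCases ?_ (fun j => ?_) i
  · simpa [extend] using measurable_snd
  · simpa [extend, Function.comp_def] using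
      (measurable_pi_apply (X := fun _ : Fin n => Fin K × ℝ) j).comp
        (measurable_fst (β := Fin K × ℝ))

instance {K : ℕ} (E : Environment K) (ρ : Policy K) (n : ℕ) :
    IsProbabilityMeasure (historyLaw E ρ n) := by
  induction n with
  | zero => unfold historyLaw; infer_instance
  | succ n ih =>
    unfold historyLaw
    exact Measure.isProbabilityMeasure_map measurable_extend.aemeasurable

/-- The regret: the sum of the best means minus the expected cumulative reward. -/
def regret {K : ℕ} (E : Environment K) (ρ : Policy K) (T : ℕ) : ℝ :=
  (∑ t ∈ Finset.range T, bestMean E t) - ∫ h, (∑ s, (h s).2) ∂(historyLaw E ρ T)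

/-- The worst-case regret of a policy over the sub-Gaussian environments within the budget. -/
def worstCaseRegret {K : ℕ} (ρ : Policy K) (a b V : ℝ) (T : ℕ) : EReal :=
  ⨆ E ∈ envClass K a b V T, (regret E ρ T : EReal)

/-- The minimax regret: the infimum of the worst-case regret over all policies. -/
def minimaxRegret (K : ℕ) (a b V : ℝ) (T : ℕ) : EReal :=
  ⨅ ρ : Policy K, worstCaseRegret ρ a b V T

/-- The slots before slot `n` that lie in the epoch of slot `n`, and in which arm `k` was
selected. The epochs are the blocks `{i * τ, …, (i + 1) * τ - 1}`. -/
def epochSamples {K n : ℕ} (τ : ℕ) (h : History K n) (k : Fin K) : Finset (Fin n) :=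
  {s | τ * (n / τ) ≤ (s : ℕ) ∧ (h s).1 = k}

/-- The number of samples of arm `k` since the last restart. -/
def epochCount {K n : ℕ} (τ : ℕ) (h : History K n) (k : Fin K) : ℕ := (epochSamples τ h k).card

/-- The empirical mean of the rewards of arm `k` since the last restart. -/
def epochMean {K n : ℕ} (τ : ℕ) (h : History K n) (k : Fin K) : ℝ :=
  (∑ s ∈ epochSamples τ h k, (h s).2) / epochCount τ h k

/-- The MOSS index of arm `k`, computed from the samples since the last restart, for a run of
MOSS over `τ` slots. -/
def mossIndex {K n : ℕ} (τ : ℕ) (h : History K n) (k : Fin K) : ℝ :=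
  epochMean τ h k +
    √(max (Real.log (τ / (K * epochCount τ h k))) 0 / epochCount τ h k)

/-- MOSS, restarted every `τ` slots, may select arm `k` after history `h`: either `k` has not been
sampled since the last restart, or all arms have been and `k` has the largest index. -/
def IsMossChoice {K n : ℕ} (τ : ℕ) (h : History K n) (k : Fin K) : Prop :=
  epochCount τ h k = 0 ∨
    ((∀ j, epochCount τ h j ≠ 0) ∧ ∀ j, mossIndex τ h j ≤ mossIndex τ h k)

/-- The policy `ρ` is MOSS restarted every `τ` slots. The order of the initial samples and the way
ties are broken, at random or not, are left free. -/
def IsResettingMoss {K : ℕ} (ρ : Policy K) (τ : ℕ) : Prop :=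
  ∀ (n : ℕ) (h : History K n), ∀ᵐ k ∂(ρ.select n h), IsMossChoice τ h k

/-- The restart period `⌈K ^ (1/3) * (T / V) ^ (2/3)⌉`. -/
def restartPeriod (K T : ℕ) (V : ℝ) : ℕ :=
  ⌈(K : ℝ) ^ (1 / 3 : ℝ) * ((T : ℝ) / V) ^ (2 / 3 : ℝ)⌉₊

theorem measurable_epochCount {K n : ℕ} (τ : ℕ) (k : Fin K) :
    Measurable fun h : History K n => epochCount τ h k := by
  simp only [epochCount, epochSamples, Finset.card_filter]
  refine Finset.measurable_sum _ fun s _ => ?_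
  refine Measurable.ite ?_ measurable_const measurable_const
  refine (MeasurableSet.const _).inter ?_
  exact (measurable_fst.comp (measurable_pi_apply s)) (measurableSet_singleton k)

theorem measurable_mossIndex {K n : ℕ} (τ : ℕ) (k : Fin K) :
    Measurable fun h : History K n => mossIndex τ h k := by
  have hc : Measurable fun h : History K n => (epochCount τ h k : ℝ) :=
    (measurable_from_top (f := fun m : ℕ => (m : ℝ))).comp (measurable_epochCount τ k)
  have hs : Measurable fun h : History K n => ∑ s ∈ epochSamples τ h k, (h s).2 := by
    simp only [epochSamples, Finset.sum_filter]
    refine Finset.measurable_sum _ fun s _ => ?_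
    refine Measurable.ite ?_ (measurable_snd.comp (measurable_pi_apply s)) measurable_const
    refine (MeasurableSet.const _).inter ?_
    exact (measurable_fst.comp (measurable_pi_apply s)) (measurableSet_singleton k)
  unfold mossIndex epochMean
  exact (hs.div hc).add
    ((((measurable_const.div (measurable_const.mul hc)).log.max measurable_const).div hc).sqrt)

theorem measurableSet_isMossChoice {K n : ℕ} (τ : ℕ) (k : Fin K) :
    MeasurableSet {h : History K n | IsMossChoice τ h k} := by
  have h0 : ∀ j : Fin K, MeasurableSet {h : History K n | epochCount τ h j = 0} := fun j =>
    measurable_epochCount τ j (measurableSet_singleton 0)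
  have h1 : ∀ j : Fin K, MeasurableSet {h : History K n | mossIndex τ h j ≤ mossIndex τ h k} :=
    fun j => measurableSet_le (measurable_mossIndex τ j) (measurable_mossIndex τ k)
  have : {h : History K n | IsMossChoice τ h k} = {h | epochCount τ h k = 0} ∪
      ((⋂ j, {h | epochCount τ h j = 0}ᶜ) ∩ ⋂ j, {h | mossIndex τ h j ≤ mossIndex τ h k}) := by
    ext h; simp [IsMossChoice]
  rw [this]
  exact (h0 k).union ((MeasurableSet.iInter fun j => (h0 j).compl).inter (MeasurableSet.iInter h1))

theorem exists_isMossChoice {K n : ℕ} (hK : 0 < K) (τ : ℕ) (h : History K n) :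
    ∃ k, IsMossChoice τ h k := by
  by_cases hj : ∃ j, epochCount τ h j = 0
  · exact hj.imp fun _ hk => Or.inl hk
  · have : Nonempty (Fin K) := ⟨⟨0, hK⟩⟩
    obtain ⟨k, hk⟩ := Finite.exists_max fun j => mossIndex τ h j
    exact ⟨k, Or.inr ⟨fun j hj' => hj ⟨j, hj'⟩, hk⟩⟩

/-- Resetting MOSS exists as a policy, for instance with ties broken by the smallest index. -/
theorem exists_isResettingMoss {K : ℕ} (hK : 0 < K) (τ : ℕ) :
    ∃ ρ : Policy K, IsResettingMoss ρ τ := by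
  classical
  let φ : (n : ℕ) → History K n → Fin K := fun n h => Fin.find _ (exists_isMossChoice hK τ h)
  have hφ : ∀ n, Measurable (φ n) := fun n => by
    refine measurable_to_countable' fun k => ?_
    have : φ n ⁻¹' {k} = {h | IsMossChoice τ h k} ∩
        ⋂ j, ⋂ (_ : j < k), {h | IsMossChoice τ h j}ᶜ := by
      ext h
      simp [φ, Fin.find_eq_iff]
    rw [this]
    exact (measurableSet_isMossChoice τ k).inter (MeasurableSet.iInter fun j =>
      MeasurableSet.iInter fun _ => (measurableSet_isMossChoice τ j).compl)
  refine ⟨⟨fun n => Kernel.deterministic (φ n) (hφ n), fun n => inferInstance⟩, fun n h => ?_⟩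
  simp only [Kernel.deterministic_apply]
  rw [ae_dirac_eq]
  exact Fin.find_spec (exists_isMossChoice hK τ h)

end

end Bandit

/-!
Upper bound. Within one epoch, the deviations of the sample sums of an arm, over all dyadic ranges
of sample sizes, are controlled by exponential supermartingales. If `S` is the logarithm of such a
supermartingale and `R` its running excess over a level `κ`, then `R + exp (S - κ - R)` is a
supermartingale, whence `𝔼 R ≤ exp (-κ)`. Summing over arms and dyadic ranges, the regret of one
epoch is at most `(b + 60) * √(K * τ)` plus a multiple of `τ` times the variation of the means in
the epoch, and the choice of `τ` balances the two terms summed over the `T / τ` epochs.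

Lower bound. On each of `T / τ` batches of `τ` slots, one arm has its mean raised by
`ε ≍ √(K / τ)`. By a Pinsker-type inequality the policy cannot tell, for a suitable arm, the raised
environment from the flat one, so it loses a constant fraction of `ε * τ`. These arms are chosen
batch after batch, and the variation of the resulting environment is at most `ε * T / τ ≤ V`.
-/

namespace Bandit

open scoped ENNReal

/-! ### The law of a history -/

section HistoryLaw

variable {K n : ℕ} {E E' : Environment K} {ρ : Policy K}

@[simp]
theorem init_extend (h : History K n) (o : Fin K × ℝ) :
    (Fin.init (extend (h, o)) : History K n) = h :=
  Fin.init_snoc (α := fun _ => Fin K × ℝ) o h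

@[simp]
theorem extend_last (h : History K n) (o : Fin K × ℝ) : extend (h, o) (Fin.last n) = o :=
  Fin.snoc_last (α := fun _ => Fin K × ℝ) o h

@[simp]
theorem extend_castSucc (h : History K n) (o : Fin K × ℝ) (s : Fin n) :
    extend (h, o) s.castSucc = h s :=
  Fin.snoc_castSucc (α := fun _ => Fin K × ℝ) o h s

theorem extend_init (h : History K (n + 1)) :
    extend ((Fin.init h : History K n), h (Fin.last n)) = h :=
  Fin.snoc_init_self h

theorem measurable_init : Measurable fun h : History K (n + 1) => (Fin.init h : History K n) :=
  measurable_pi_lambda _ fun i => measurable_pi_apply i.castSucc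

theorem lintegral_stepKernel (h : History K n) {f : Fin K × ℝ → ℝ≥0∞} (hf : Measurable f) :
    ∫⁻ o, f o ∂(stepKernel E ρ n h) =
      ∫⁻ k, ∫⁻ x, f (k, x) ∂(E n k : Measure ℝ) ∂(ρ.select n h) := by
  rw [stepKernel, Kernel.lintegral_compProd _ _ _ hf]
  rfl

theorem lintegral_historyLaw_succ {f : History K (n + 1) → ℝ≥0∞} (hf : Measurable f) :
    ∫⁻ h, f h ∂(historyLaw E ρ (n + 1)) =
      ∫⁻ h, ∫⁻ o, f (extend (h, o)) ∂(stepKernel E ρ n h) ∂(historyLaw E ρ n) := by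
  rw [historyLaw, lintegral_map hf measurable_extend,
    Measure.lintegral_compProd (f := fun p => f (extend p)) (hf.comp measurable_extend)]

theorem historyLaw_congr (hE : ∀ t < n, E t = E' t) :
    historyLaw E ρ n = historyLaw E' ρ n := by
  induction n with
  | zero => rfl
  | succ n ih =>
    have hs : stepKernel E ρ n = stepKernel E' ρ n := by
      simp only [stepKernel, rewardKernel, hE n n.lt_succ_self]
    simp only [historyLaw, ih fun t ht => hE t (ht.trans n.lt_succ_self), hs]

theorem measurePreserving_init :
    MeasurePreserving (fun h : History K (n + 1) => (Fin.init h : History K n))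
      (historyLaw E ρ (n + 1)) (historyLaw E ρ n) := by
  refine ⟨measurable_init, Measure.ext_of_lintegral _ fun f hf => ?_⟩
  rw [lintegral_map hf measurable_init, lintegral_historyLaw_succ
    (f := fun h => f (Fin.init h : History K n)) (hf.comp measurable_init)]
  simp only [init_extend, lintegral_const, measure_univ, mul_one]

/-- The unconditional law of the arm that policy `ρ` selects in slot `n`. -/
noncomputable def armLaw (E : Environment K) (ρ : Policy K) (n : ℕ) : Measure (Fin K) :=
  ρ.select n ∘ₘ historyLaw E ρ n

instance : IsProbabilityMeasure (armLaw E ρ n) := by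
  unfold armLaw; infer_instance

theorem armLaw_congr (hE : ∀ t < n, E t = E' t) : armLaw E ρ n = armLaw E' ρ n := by
  simp only [armLaw, historyLaw_congr hE]

theorem measurePreserving_last :
    MeasurePreserving (fun h : History K (n + 1) => h (Fin.last n))
      (historyLaw E ρ (n + 1)) (armLaw E ρ n ⊗ₘ rewardKernel E n) := by
  refine ⟨measurable_pi_apply _, Measure.ext_of_lintegral _ fun f hf => ?_⟩
  rw [lintegral_map hf (measurable_pi_apply _), lintegral_historyLaw_succ
    (f := fun h => f (h (Fin.last n))) (hf.comp (measurable_pi_apply _)),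
    Measure.lintegral_compProd hf, armLaw, Measure.lintegral_bind (Kernel.aemeasurable _)
      (measurable_of_finite _).aemeasurable]
  simp only [extend_last, lintegral_stepKernel _ hf]
  rfl

theorem measurePreserving_eval (s : Fin n) :
    MeasurePreserving (fun h : History K n => h s)
      (historyLaw E ρ n) (armLaw E ρ s ⊗ₘ rewardKernel E s) := by
  induction n with
  | zero => exact s.elim0
  | succ n ih =>
    induction s using Fin.lastCases with
    | last => exact measurePreserving_last
    | cast s => exact (ih s).comp measurePreserving_init

end HistoryLaw

/-! ### Additive functionals of a history -/

section Cumul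

variable {K n s₀ : ℕ} {E : Environment K} {ρ : Policy K} {F : ℕ → Fin K × ℝ → ℝ}

/-- The additive functional `∑ s ≥ s₀, F s (h s)` of a history: the common form of rewards,
regrets, counts and log-likelihood ratios accumulated from slot `s₀` on. -/
noncomputable def cumul (s₀ : ℕ) (F : ℕ → Fin K × ℝ → ℝ) (h : History K n) : ℝ :=
  ∑ s : Fin n, if s₀ ≤ s then F s (h s) else 0

theorem cumul_of_le (hn : n ≤ s₀) (h : History K n) : cumul s₀ F h = 0 :=
  Finset.sum_eq_zero fun s _ => if_neg (not_le.2 (s.2.trans_le hn))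

theorem cumul_extend (h : History K n) (o : Fin K × ℝ) :
    cumul s₀ F (extend (h, o)) = cumul s₀ F h + if s₀ ≤ n then F n o else 0 := by
  simp [cumul, Fin.sum_univ_castSucc]

theorem measurable_cumul (hF : ∀ t, Measurable (F t)) :
    Measurable fun h : History K n => cumul s₀ F h :=
  Finset.measurable_sum _ fun s _ =>
    Measurable.ite (MeasurableSet.const _) ((hF s).comp (measurable_pi_apply s)) measurable_const

theorem integrable_eval {s : Fin n} (hF : Measurable (F s))
    (hi : ∀ k, Integrable (fun x => F s (k, x)) (E s k : Measure ℝ)) :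
    Integrable (fun h : History K n => F s (h s)) (historyLaw E ρ n) :=
  (measurePreserving_eval s).integrable_comp_of_integrable <|
    (Measure.integrable_compProd_iff hF.aestronglyMeasurable).2
      ⟨ae_of_all _ hi, Integrable.of_finite⟩

theorem integral_eval {s : Fin n} (hF : Measurable (F s))
    (hi : ∀ k, Integrable (fun x => F s (k, x)) (E s k : Measure ℝ)) :
    ∫ h : History K n, F s (h s) ∂(historyLaw E ρ n) =
      ∫ k, ∫ x, F s (k, x) ∂(E s k : Measure ℝ) ∂(armLaw E ρ s) := by
  have hFi : Integrable (F s) (armLaw E ρ s ⊗ₘ rewardKernel E s) :=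
    (Measure.integrable_compProd_iff hF.aestronglyMeasurable).2
      ⟨ae_of_all _ hi, Integrable.of_finite⟩
  rw [← integral_map (φ := fun h : History K n => h s) (measurable_pi_apply s).aemeasurable
    hF.aestronglyMeasurable, (measurePreserving_eval s).map_eq, Measure.integral_compProd hFi]
  rfl

theorem integrable_cumul (hF : ∀ t, Measurable (F t))
    (hi : ∀ t, s₀ ≤ t → t < n → ∀ k, Integrable (fun x => F t (k, x)) (E t k : Measure ℝ)) :
    Integrable (fun h : History K n => cumul s₀ F h) (historyLaw E ρ n) := by
  refine integrable_finsetSum _ fun s _ => ?_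
  split_ifs with hs
  · exact integrable_eval (hF s) (hi s hs s.2)
  · exact integrable_const 0

theorem integral_cumul (hF : ∀ t, Measurable (F t))
    (hi : ∀ t, s₀ ≤ t → t < n → ∀ k, Integrable (fun x => F t (k, x)) (E t k : Measure ℝ)) :
    ∫ h : History K n, cumul s₀ F h ∂(historyLaw E ρ n) =
      ∑ t ∈ Finset.Ico s₀ n, ∫ k, ∫ x, F t (k, x) ∂(E t k : Measure ℝ) ∂(armLaw E ρ t) := by
  have hIco : Finset.Ico s₀ n = (Finset.range n).filter (s₀ ≤ ·) := by
    ext t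
    simp only [Finset.mem_Ico, Finset.mem_filter, Finset.mem_range, and_comm]
  rw [hIco, Finset.sum_filter, ← Fin.sum_univ_eq_sum_range (fun t => if s₀ ≤ t then
    ∫ k, ∫ x, F t (k, x) ∂(E t k : Measure ℝ) ∂(armLaw E ρ t) else 0)]
  simp only [cumul]
  rw [integral_finsetSum]
  · refine Finset.sum_congr rfl fun s _ => ?_
    split_ifs with hs
    · exact integral_eval (hF s) (hi s hs s.2)
    · exact integral_zero _ _
  · intro s _
    split_ifs with hs
    · exact integrable_eval (hF s) (hi s hs s.2)
    · exact integrable_const 0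

end Cumul

/-! ### The regret as an additive functional -/

section Regret

variable {K : ℕ} {E : Environment K} {ρ : Policy K}

theorem mean_le_bestMean (t : ℕ) (k : Fin K) : mean E t k ≤ bestMean E t :=
  le_ciSup (Set.finite_range fun k => mean E t k).bddAbove k

theorem IsSubGaussianEnv.integrable_id {a b : ℝ} {T : ℕ} (hE : IsSubGaussianEnv E a b T) {t : ℕ}
    (ht : t < T) (k : Fin K) : Integrable (fun x => x) (E t k : Measure ℝ) := by
  simpa [Pi.add_def] using (hE t ht k).1.integrable.add (integrable_const (mean E t k))

/-- The gap between the best mean of slot `t` and the mean of the selected arm. -/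
noncomputable def gap (E : Environment K) (t : ℕ) (o : Fin K × ℝ) : ℝ :=
  bestMean E t - mean E t o.1

theorem measurable_gap (t : ℕ) : Measurable (gap E t) :=
  measurable_const.sub ((measurable_of_finite fun k => mean E t k).comp measurable_fst)

/-- The expected gap of the arm selected in slot `t`: the regret incurred in that slot. -/
noncomputable def slotRegret (E : Environment K) (ρ : Policy K) (t : ℕ) : ℝ :=
  ∫ k, (bestMean E t - mean E t k) ∂(armLaw E ρ t)

theorem integral_cumul_gap (s₀ n : ℕ) :
    ∫ h : History K n, cumul s₀ (gap E) h ∂(historyLaw E ρ n) =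
      ∑ t ∈ Finset.Ico s₀ n, slotRegret E ρ t := by
  rw [integral_cumul measurable_gap fun t _ _ k => integrable_const (bestMean E t - mean E t k)]
  refine Finset.sum_congr rfl fun t _ => ?_
  simp only [gap, integral_const, probReal_univ, one_smul, slotRegret]

theorem integrable_cumul_gap (s₀ n : ℕ) :
    Integrable (fun h : History K n => cumul s₀ (gap E) h) (historyLaw E ρ n) :=
  integrable_cumul measurable_gap fun t _ _ k => integrable_const (bestMean E t - mean E t k)

theorem IsSubGaussianEnv.regret_eq_sum {a b : ℝ} {T : ℕ} (hE : IsSubGaussianEnv E a b T) :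
    regret E ρ T = ∑ t ∈ Finset.range T, slotRegret E ρ t := by
  have h := integral_cumul (E := E) (ρ := ρ) (F := fun _ o => o.2) (s₀ := 0) (n := T)
    (fun _ => measurable_snd) fun t _ ht k => hE.integrable_id ht k
  simp only [cumul, zero_le, if_true, Nat.Ico_zero_eq_range] at h
  rw [regret, h, ← Finset.sum_sub_distrib]
  refine Finset.sum_congr rfl fun t _ => ?_
  rw [slotRegret, integral_sub (integrable_const _) Integrable.of_finite, integral_const,
    probReal_univ, one_smul]
  rfl

theorem IsSubGaussianEnv.gap_le {a b : ℝ} {T : ℕ} (hE : IsSubGaussianEnv E a b T) {t : ℕ}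
    (ht : t < T) (k : Fin K) : bestMean E t - mean E t k ≤ b := by
  have : Nonempty (Fin K) := ⟨k⟩
  have hbest : bestMean E t ≤ a + b := ciSup_le fun j => (hE t ht j).2.2
  linarith [(hE t ht k).2.1]

theorem IsSubGaussianEnv.regret_le_mul {a b : ℝ} {T : ℕ} (hE : IsSubGaussianEnv E a b T) :
    regret E ρ T ≤ b * T := by
  calc regret E ρ T = ∑ t ∈ Finset.range T, slotRegret E ρ t := hE.regret_eq_sum
    _ ≤ ∑ _t ∈ Finset.range T, b := by
        refine Finset.sum_le_sum fun t ht => ?_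
        refine (integral_mono Integrable.of_finite (integrable_const b) fun k =>
          hE.gap_le (Finset.mem_range.1 ht) k).trans_eq ?_
        rw [integral_const, probReal_univ, one_smul]
    _ = b * T := by rw [Finset.sum_const, Finset.card_range, nsmul_eq_mul, mul_comm]

end Regret

/-! ### The running excess of an exponential supermartingale -/

section RunExcess

variable {K n s₀ : ℕ} {E : Environment K} {ρ : Policy K} {F : ℕ → Fin K × ℝ → ℝ} {κ : ℝ}

/-- The largest excess of `cumul s₀ F` over the level `κ` so far, or `0` if the level has not been
exceeded. -/
noncomputable def runExcess (s₀ : ℕ) (F : ℕ → Fin K × ℝ → ℝ) (κ : ℝ) : {n : ℕ} → History K n → ℝ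
  | 0, _ => max 0 (-κ)
  | n + 1, h => max (runExcess s₀ F κ (Fin.init h : History K n)) (cumul s₀ F h - κ)

theorem runExcess_extend (h : History K n) (o : Fin K × ℝ) :
    runExcess s₀ F κ (extend (h, o)) =
      max (runExcess s₀ F κ h) (cumul s₀ F (extend (h, o)) - κ) := by
  simp only [runExcess, init_extend]

theorem runExcess_nonneg (h : History K n) : 0 ≤ runExcess s₀ F κ h := by
  induction n with
  | zero => exact le_max_left _ _
  | succ n ih => exact (ih _).trans (le_max_left _ _)

theorem cumul_sub_le_runExcess (h : History K n) : cumul s₀ F h - κ ≤ runExcess s₀ F κ h := by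
  cases n with
  | zero => simp [runExcess, cumul]
  | succ n => exact le_max_right _ _

theorem measurable_runExcess (hF : ∀ t, Measurable (F t)) :
    Measurable fun h : History K n => runExcess s₀ F κ h := by
  induction n with
  | zero => exact measurable_const
  | succ n ih => exact (ih.comp measurable_init).max ((measurable_cumul hF).sub_const κ)

/-- The running excess, augmented so that it becomes a supermartingale when `exp (cumul s₀ F)` is
one. -/
noncomputable def excessPotential (s₀ : ℕ) (F : ℕ → Fin K × ℝ → ℝ) (κ : ℝ) (h : History K n) : ℝ :=
  runExcess s₀ F κ h + Real.exp (cumul s₀ F h - κ - runExcess s₀ F κ h)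

theorem measurable_excessPotential (hF : ∀ t, Measurable (F t)) :
    Measurable fun h : History K n => excessPotential s₀ F κ h :=
  (measurable_runExcess hF).add
    (((measurable_cumul hF).sub_const κ).sub (measurable_runExcess hF)).exp

theorem max_add_exp_sub_max_le (x y : ℝ) :
    max x y + Real.exp (y - max x y) ≤ x + Real.exp (y - x) := by
  rcases le_total x y with h | h
  · rw [max_eq_right h, sub_self, Real.exp_zero]
    linarith [Real.add_one_le_exp (y - x)]
  · rw [max_eq_left h]

theorem lintegral_excessPotential_extend_le (hF : Measurable (F n))
    (hmgf : s₀ ≤ n → ∀ k, ∫⁻ x, ENNReal.ofReal (Real.exp (F n (k, x))) ∂(E n k : Measure ℝ) ≤ 1)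
    (h : History K n) :
    ∫⁻ o, ENNReal.ofReal (excessPotential s₀ F κ (extend (h, o))) ∂(stepKernel E ρ n h) ≤
      ENNReal.ofReal (excessPotential s₀ F κ h) := by
  set R := runExcess s₀ F κ h
  set D := cumul s₀ F h - κ with hD
  set G : Fin K × ℝ → ℝ := fun o => if s₀ ≤ n then F n o else 0 with hG
  have hGm : Measurable fun o => ENNReal.ofReal (Real.exp (G o)) :=
    (Measurable.ite (MeasurableSet.const _) hF measurable_const).exp.ennreal_ofReal
  have hG1 : ∫⁻ o, ENNReal.ofReal (Real.exp (G o)) ∂(stepKernel E ρ n h) ≤ 1 := by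
    rw [lintegral_stepKernel h hGm]
    refine (lintegral_mono fun k => ?_).trans_eq
      ((lintegral_const (μ := ρ.select n h) 1).trans (by rw [measure_univ, mul_one]))
    by_cases hn : s₀ ≤ n
    · simpa only [hG, if_pos hn] using hmgf hn k
    · simp [hG, hn]
  have hstep : ∀ o, excessPotential s₀ F κ (extend (h, o)) ≤
      R + Real.exp (D - R) * Real.exp (G o) := fun o => by
    have he : cumul s₀ F (extend (h, o)) - κ = D + G o := by
      rw [cumul_extend, hD]; ring
    rw [excessPotential, runExcess_extend, he, ← Real.exp_add]
    exact (max_add_exp_sub_max_le R (D + G o)).trans_eq (by ring_nf)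
  have hR0 : 0 ≤ R := runExcess_nonneg h
  calc _ ≤ ∫⁻ o, (ENNReal.ofReal R + ENNReal.ofReal (Real.exp (D - R)) *
            ENNReal.ofReal (Real.exp (G o))) ∂(stepKernel E ρ n h) := by
        refine lintegral_mono fun o => (ENNReal.ofReal_le_ofReal (hstep o)).trans_eq ?_
        rw [ENNReal.ofReal_add hR0 (by positivity), ENNReal.ofReal_mul (by positivity)]
    _ = ENNReal.ofReal R + ENNReal.ofReal (Real.exp (D - R)) *
          ∫⁻ o, ENNReal.ofReal (Real.exp (G o)) ∂(stepKernel E ρ n h) := by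
        rw [lintegral_add_left measurable_const, lintegral_const_mul _ hGm, lintegral_const,
          measure_univ, mul_one]
    _ ≤ ENNReal.ofReal R + ENNReal.ofReal (Real.exp (D - R)) * 1 := by gcongr
    _ = ENNReal.ofReal (excessPotential s₀ F κ h) := by
        rw [mul_one, excessPotential, ENNReal.ofReal_add hR0 (Real.exp_nonneg _)]

theorem lintegral_excessPotential_le (hF : ∀ t, Measurable (F t))
    (hmgf : ∀ t, s₀ ≤ t → t < n → ∀ k,
      ∫⁻ x, ENNReal.ofReal (Real.exp (F t (k, x))) ∂(E t k : Measure ℝ) ≤ 1) :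
    ∫⁻ h : History K n, ENNReal.ofReal (excessPotential s₀ F κ h) ∂(historyLaw E ρ n) ≤
      ENNReal.ofReal (Real.exp (-κ)) := by
  induction n with
  | zero =>
    have hinit : ∀ h : History K 0, excessPotential s₀ F κ h ≤ Real.exp (-κ) := fun h => by
      simpa [excessPotential, runExcess, cumul] using max_add_exp_sub_max_le 0 (-κ)
    refine (lintegral_mono fun h => ENNReal.ofReal_le_ofReal (hinit h)).trans_eq ?_
    rw [lintegral_const, measure_univ, mul_one]
  | succ n ih =>
    rw [lintegral_historyLaw_succ (measurable_excessPotential hF).ennreal_ofReal]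
    exact (lintegral_mono (lintegral_excessPotential_extend_le (hF n)
      fun hn => hmgf n hn n.lt_succ_self)).trans
      (ih fun t ht htn => hmgf t ht (htn.trans n.lt_succ_self))

theorem lintegral_runExcess_le (hF : ∀ t, Measurable (F t))
    (hmgf : ∀ t, s₀ ≤ t → t < n → ∀ k,
      ∫⁻ x, ENNReal.ofReal (Real.exp (F t (k, x))) ∂(E t k : Measure ℝ) ≤ 1) :
    ∫⁻ h : History K n, ENNReal.ofReal (runExcess s₀ F κ h) ∂(historyLaw E ρ n) ≤
      ENNReal.ofReal (Real.exp (-κ)) :=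
  (lintegral_mono fun _ => ENNReal.ofReal_le_ofReal
    (le_add_of_nonneg_right (Real.exp_nonneg _))).trans (lintegral_excessPotential_le hF hmgf)

theorem integrable_runExcess (hF : ∀ t, Measurable (F t))
    (hmgf : ∀ t, s₀ ≤ t → t < n → ∀ k,
      ∫⁻ x, ENNReal.ofReal (Real.exp (F t (k, x))) ∂(E t k : Measure ℝ) ≤ 1) :
    Integrable (fun h : History K n => runExcess s₀ F κ h) (historyLaw E ρ n) := by
  refine ⟨(measurable_runExcess hF).aestronglyMeasurable, ?_⟩
  rw [hasFiniteIntegral_iff_ofReal (ae_of_all _ runExcess_nonneg)]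
  exact (lintegral_runExcess_le hF hmgf).trans_lt ENNReal.ofReal_lt_top

theorem integral_runExcess_le (hF : ∀ t, Measurable (F t))
    (hmgf : ∀ t, s₀ ≤ t → t < n → ∀ k,
      ∫⁻ x, ENNReal.ofReal (Real.exp (F t (k, x))) ∂(E t k : Measure ℝ) ≤ 1) :
    ∫ h : History K n, runExcess s₀ F κ h ∂(historyLaw E ρ n) ≤ Real.exp (-κ) := by
  rw [integral_eq_lintegral_of_nonneg_ae (ae_of_all _ runExcess_nonneg)
    (measurable_runExcess hF).aestronglyMeasurable]
  exact ENNReal.toReal_le_of_le_ofReal (Real.exp_nonneg _) (lintegral_runExcess_le hF hmgf)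

end RunExcess

/-! ### Deviations of the sample sums of one arm -/

section Deviation

variable {K n s₀ : ℕ} {E : Environment K} {ρ : Policy K} {k : Fin K}

/-- The slots from `s₀` on in which arm `k` was selected. `epochSamples` is the case where `s₀` is
the start of the current epoch. -/
def windowSamples (s₀ : ℕ) (h : History K n) (k : Fin K) : Finset (Fin n) :=
  {s | s₀ ≤ (s : ℕ) ∧ (h s).1 = k}

/-- The number of samples of arm `k` from slot `s₀` on. -/
def windowCount (s₀ : ℕ) (h : History K n) (k : Fin K) : ℕ := (windowSamples s₀ h k).card

/-- The summands of the number of samples of arm `k`. -/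
noncomputable def armIndicator (k : Fin K) (_t : ℕ) (o : Fin K × ℝ) : ℝ := if o.1 = k then 1 else 0

theorem measurable_armIndicator (t : ℕ) : Measurable (armIndicator k t) :=
  Measurable.ite (measurable_fst (measurableSet_singleton k)) measurable_const measurable_const

theorem windowCount_eq_cumul (h : History K n) :
    (windowCount s₀ h k : ℝ) = cumul s₀ (armIndicator k) h := by
  simp only [windowCount, windowSamples, Finset.card_filter, Nat.cast_sum, cumul, armIndicator,
    ← ite_and, Nat.cast_ite, Nat.cast_one, Nat.cast_zero]

theorem windowCount_extend (h : History K n) (o : Fin K × ℝ) :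
    windowCount s₀ (extend (h, o)) k =
      windowCount s₀ h k + if s₀ ≤ n ∧ o.1 = k then 1 else 0 := by
  simp only [windowCount, windowSamples, Finset.card_filter, Fin.sum_univ_castSucc,
    extend_castSucc, extend_last, Fin.val_castSucc, Fin.val_last]

/-- The summands of the centred sample sum of arm `k`. -/
noncomputable def noise (E : Environment K) (k : Fin K) (t : ℕ) (o : Fin K × ℝ) : ℝ :=
  if o.1 = k then o.2 - mean E t k else 0

/-- The increments of the logarithm of the exponential supermartingale of arm `k`. -/
noncomputable def tilt (E : Environment K) (k : Fin K) (l : ℝ) (t : ℕ) (o : Fin K × ℝ) : ℝ :=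
  if o.1 = k then l * (o.2 - mean E t k) - l ^ 2 / 8 else 0

theorem measurable_tilt (l : ℝ) (t : ℕ) : Measurable (tilt E k l t) :=
  Measurable.ite (measurable_fst (measurableSet_singleton k))
    (((measurable_snd.sub_const _).const_mul l).sub_const _) measurable_const

theorem cumul_tilt (l : ℝ) (h : History K n) :
    cumul s₀ (tilt E k l) h = l * cumul s₀ (noise E k) h - l ^ 2 / 8 * windowCount s₀ h k := by
  simp only [windowCount_eq_cumul, cumul, Finset.mul_sum, ← Finset.sum_sub_distrib]
  refine Finset.sum_congr rfl fun s _ => ?_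
  simp only [tilt, noise, armIndicator]
  split_ifs <;> simp

theorem lintegral_exp_tilt_le {t : ℕ} (j : Fin K)
    (hE : HasSubgaussianMGF (fun x => x - mean E t j) (1 / 4) (E t j : Measure ℝ)) (l : ℝ) :
    ∫⁻ x, ENNReal.ofReal (Real.exp (tilt E k l t (j, x))) ∂(E t j : Measure ℝ) ≤ 1 := by
  by_cases hj : j = k
  · subst hj
    simp only [tilt, if_true, Real.exp_sub]
    rw [← ofReal_integral_eq_lintegral_ofReal ((hE.integrable_exp_mul l).div_const _)
      (ae_of_all _ fun x => by positivity), integral_div, ← ENNReal.ofReal_one]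
    refine ENNReal.ofReal_le_ofReal ((div_le_one (Real.exp_pos _)).2 ((hE.mgf_le l).trans_eq ?_))
    congr 1
    push_cast
    ring
  · simp [tilt, hj]

/-- The slope of the exponential supermartingale that bounds the deviations of about `m` samples
from their mean by `θ`. It solves `m * (l / 2 - θ) ^ 2 = 1`. -/
noncomputable def slope (m θ : ℝ) : ℝ := 2 * θ + 2 / √m

theorem slope_pos {m θ : ℝ} (hm : 0 < m) (hθ : 0 ≤ θ) : 0 < slope m θ := by
  unfold slope; positivity

theorem slope_mul {m : ℝ} (hm : 0 < m) (θ : ℝ) :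
    slope m θ * (m * θ) = slope m θ ^ 2 / 8 * (2 * m) + (m * θ ^ 2 - 1) := by
  have hs : 0 < √m := Real.sqrt_pos.2 hm
  have hsq : √m ^ 2 = m := Real.sq_sqrt hm.le
  rw [slope]
  generalize √m = r at hs hsq
  subst hsq
  field_simp
  ring

/-- An upper bound for the excess of `σ` times the noise sum of arm `k` over `m * θ`, valid as long
as arm `k` has at most `2 * m` samples. -/
noncomputable def excess (E : Environment K) (s₀ : ℕ) (k : Fin K) (σ m θ : ℝ)
    (h : History K n) : ℝ :=
  runExcess s₀ (tilt E k (σ * slope m θ)) (m * θ ^ 2 - 1) h / slope m θ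

variable {σ m θ : ℝ}

theorem excess_nonneg (hm : 0 < m) (hθ : 0 ≤ θ) (h : History K n) : 0 ≤ excess E s₀ k σ m θ h :=
  div_nonneg (runExcess_nonneg h) (slope_pos hm hθ).le

theorem excess_le_extend (hm : 0 < m) (hθ : 0 ≤ θ) (h : History K n) (o : Fin K × ℝ) :
    excess E s₀ k σ m θ h ≤ excess E s₀ k σ m θ (extend (h, o)) := by
  have := (slope_pos hm hθ).le
  unfold excess
  gcongr
  exact (le_max_left _ _).trans_eq (runExcess_extend h o).symm

theorem mul_cumul_noise_le (hσ : σ ^ 2 = 1) (hm : 0 < m) (hθ : 0 ≤ θ) (h : History K n)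
    (hc : (windowCount s₀ h k : ℝ) ≤ 2 * m) :
    σ * cumul s₀ (noise E k) h ≤ m * θ + excess E s₀ k σ m θ h := by
  have hl := slope_pos hm hθ
  have hr := cumul_sub_le_runExcess (s₀ := s₀) (F := tilt E k (σ * slope m θ))
    (κ := m * θ ^ 2 - 1) h
  rw [cumul_tilt, mul_pow, hσ, one_mul] at hr
  have hexc : slope m θ * excess E s₀ k σ m θ h =
      runExcess s₀ (tilt E k (σ * slope m θ)) (m * θ ^ 2 - 1) h := mul_div_cancel₀ _ hl.ne'
  have hcount : slope m θ ^ 2 / 8 * (windowCount s₀ h k : ℝ) ≤ slope m θ ^ 2 / 8 * (2 * m) := by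
    gcongr
  refine le_of_mul_le_mul_left ?_ hl
  rw [mul_add, hexc, slope_mul hm]
  linarith

theorem exp_one_sub_div_slope_le (hm : 0 < m) (hθ : 0 ≤ θ) (x : ℝ) :
    Real.exp (1 - x) / slope m θ ≤ 3 / 2 * (√m * Real.exp (-x)) := by
  have : 0 < √m := Real.sqrt_pos.2 hm
  calc Real.exp (1 - x) / slope m θ ≤ Real.exp (1 - x) / (2 / √m) := by
        unfold slope
        gcongr
        linarith
    _ = Real.exp 1 / 2 * (√m * Real.exp (-x)) := by
        rw [sub_eq_add_neg, Real.exp_add]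
        field_simp
    _ ≤ 3 / 2 * (√m * Real.exp (-x)) := by
        gcongr
        exact Real.exp_one_lt_three.le

theorem integrable_excess (hE : ∀ t, s₀ ≤ t → t < n → ∀ j,
      HasSubgaussianMGF (fun x => x - mean E t j) (1 / 4) (E t j : Measure ℝ)) :
    Integrable (fun h : History K n => excess E s₀ k σ m θ h) (historyLaw E ρ n) :=
  (integrable_runExcess (measurable_tilt _)
    fun t ht htn j => lintegral_exp_tilt_le j (hE t ht htn j) _).div_const _

theorem integral_excess_le (hE : ∀ t, s₀ ≤ t → t < n → ∀ j,
      HasSubgaussianMGF (fun x => x - mean E t j) (1 / 4) (E t j : Measure ℝ))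
    (hm : 0 < m) (hθ : 0 ≤ θ) :
    ∫ h : History K n, excess E s₀ k σ m θ h ∂(historyLaw E ρ n) ≤
      3 / 2 * (√m * Real.exp (-(m * θ ^ 2))) := by
  have hl := (slope_pos hm hθ).le
  calc ∫ h : History K n, excess E s₀ k σ m θ h ∂(historyLaw E ρ n)
      = (∫ h : History K n, runExcess s₀ (tilt E k (σ * slope m θ)) (m * θ ^ 2 - 1) h
          ∂(historyLaw E ρ n)) / slope m θ := integral_div _ _
    _ ≤ Real.exp (-(m * θ ^ 2 - 1)) / slope m θ := by
        gcongr
        exact integral_runExcess_le (measurable_tilt _)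
          fun t ht htn j => lintegral_exp_tilt_le j (hE t ht htn j) _
    _ = Real.exp (1 - m * θ ^ 2) / slope m θ := by rw [neg_sub]
    _ ≤ 3 / 2 * (√m * Real.exp (-(m * θ ^ 2))) := exp_one_sub_div_slope_le hm hθ _

end Deviation

/-! ### Sums of bonuses and dyadic sums -/

section Sums

/-- The exploration bonus of an arm with `n` samples, where `A` is the quotient of the length of
the run and the number of arms. -/
noncomputable def bonus (A : ℝ) (n : ℕ) : ℝ := √(max (Real.log (A / n)) 0 / n)

theorem bonus_nonneg (A : ℝ) (n : ℕ) : 0 ≤ bonus A n := Real.sqrt_nonneg _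

theorem bonus_eq_zero {A : ℝ} {n : ℕ} (hA : 0 ≤ A) (hn : A ≤ n) : bonus A n = 0 := by
  have hlog : Real.log (A / n) ≤ 0 :=
    Real.log_nonpos (by positivity) (div_le_one_of_le₀ hn (by positivity))
  rw [bonus, max_eq_right hlog, zero_div, Real.sqrt_zero]

theorem bonus_le_rpow {A : ℝ} {n : ℕ} (hA : 0 ≤ A) (hn : 0 < n) :
    bonus A n ≤ √2 * A ^ (1 / 4 : ℝ) * (n : ℝ) ^ (1 / 4 - 1 : ℝ) := by
  have hn' : (0 : ℝ) < n := Nat.cast_pos.2 hn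
  have hlog : max (Real.log (A / n)) 0 ≤ 2 * √(A / n) := by
    refine max_le ((Real.log_le_rpow_div (by positivity) one_half_pos).trans_eq ?_) (by positivity)
    rw [Real.sqrt_eq_rpow]
    ring
  refine Real.sqrt_le_iff.2 ⟨by positivity, ?_⟩
  calc max (Real.log (A / n)) 0 / n ≤ 2 * √(A / n) / n := by gcongr
    _ = 2 * (A ^ (1 / 2 : ℝ) * ((n : ℝ) ^ (-(1 / 2) : ℝ) * (n : ℝ) ^ (-1 : ℝ))) := by
        rw [Real.sqrt_eq_rpow, Real.div_rpow hA hn'.le, Real.rpow_neg hn'.le, Real.rpow_neg_one]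
        ring
    _ = (√2 * A ^ (1 / 4 : ℝ) * (n : ℝ) ^ (1 / 4 - 1 : ℝ)) ^ 2 := by
        rw [← Real.rpow_add hn', mul_pow, mul_pow, Real.sq_sqrt two_pos.le,
          ← Real.rpow_mul_natCast hA, ← Real.rpow_mul_natCast hn'.le]
        norm_num [mul_assoc]

theorem sum_mul_rpow_sub_one_le {p : ℝ} (hp₀ : 0 ≤ p) (hp₁ : p ≤ 1) (N : ℕ) :
    ∑ i ∈ Finset.range N, p * ((i + 1 : ℕ) : ℝ) ^ (p - 1) ≤ (N : ℝ) ^ p := by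
  induction N with
  | zero => simpa using Real.rpow_nonneg le_rfl p
  | succ N ih =>
    rw [Finset.sum_range_succ]
    set x : ℝ := ((N + 1 : ℕ) : ℝ) with hx
    have hx0 : 0 < x := Nat.cast_pos.2 N.succ_pos
    have hN : (N : ℝ) = x * (1 + -x⁻¹) := by
      rw [hx]; push_cast; field_simp; ring
    have hinv : x⁻¹ ≤ 1 := inv_le_one_of_one_le₀ (by simp [hx])
    have hbern : (N : ℝ) ^ p ≤ x ^ p * (1 + p * -x⁻¹) := by
      rw [hN, Real.mul_rpow hx0.le (by linarith)]
      gcongr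
      exact rpow_one_add_le_one_add_mul_self (by linarith) hp₀ hp₁
    have hsub : x ^ p * (1 + p * -x⁻¹) = x ^ p - p * x ^ (p - 1) := by
      rw [Real.rpow_sub_one hx0.ne']; ring
    linarith

theorem sum_bonus_le {A : ℝ} (hA : 0 ≤ A) (N : ℕ) :
    ∑ i ∈ Finset.Ico 1 N, bonus A i ≤ 6 * √A := by
  have hcut : ∑ i ∈ Finset.Ico 1 N, bonus A i ≤ ∑ i ∈ Finset.Ico 1 (⌊A⌋₊ + 1), bonus A i := by
    refine (Finset.sum_le_sum_of_subset_of_nonneg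
      (Finset.Ico_subset_Ico_right (le_max_left N (⌊A⌋₊ + 1)))
      fun i _ _ => bonus_nonneg A i).trans_eq (Eq.symm ?_)
    refine Finset.sum_subset (Finset.Ico_subset_Ico_right (le_max_right _ _)) fun i hi hi' => ?_
    simp only [Finset.mem_Ico, not_and, not_lt, Nat.succ_le_iff] at hi hi'
    exact bonus_eq_zero hA ((Nat.floor_lt hA).1 (hi' hi.1)).le
  have hsqrt : √2 ≤ 3 / 2 := Real.sqrt_le_iff.2 (by norm_num)
  calc ∑ i ∈ Finset.Ico 1 N, bonus A i ≤ ∑ i ∈ Finset.range ⌊A⌋₊, bonus A (i + 1) := by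
        refine hcut.trans_eq ?_
        rw [Finset.sum_Ico_eq_sum_range, Nat.add_sub_cancel]
        simp only [add_comm 1]
    _ ≤ ∑ i ∈ Finset.range ⌊A⌋₊,
          4 * √2 * A ^ (1 / 4 : ℝ) * (1 / 4 * ((i + 1 : ℕ) : ℝ) ^ (1 / 4 - 1 : ℝ)) := by
        refine Finset.sum_le_sum fun i _ => (bonus_le_rpow hA i.succ_pos).trans_eq (by ring)
    _ ≤ 4 * √2 * A ^ (1 / 4 : ℝ) * A ^ (1 / 4 : ℝ) := by
        rw [← Finset.mul_sum]
        gcongr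
        refine (sum_mul_rpow_sub_one_le (by norm_num) (by norm_num) _).trans ?_
        gcongr
        exact Nat.floor_le hA
    _ = 4 * √2 * √A := by
        rw [mul_assoc, ← Real.rpow_add_of_nonneg hA (by norm_num) (by norm_num),
          Real.sqrt_eq_rpow A]
        norm_num
    _ ≤ 6 * √A := by gcongr; linarith

theorem div_le_mul_sqrt_two_div_sub {x y : ℝ} (hx : 0 < x) (hy : 0 < y) :
    y / (1 + y ^ 2 / x ^ 2) ≤ 7 * x * (√2 * y / (x + √2 * y)) - 7 * x * (y / (x + y)) := by
  have hq₁ : (1.414 : ℝ) ≤ √2 := Real.le_sqrt_of_sq_le (by norm_num)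
  have hq₂ : √(2 : ℝ) ≤ 1.415 := Real.sqrt_le_iff.2 ⟨by norm_num, by norm_num⟩
  generalize √(2 : ℝ) = q at hq₁ hq₂
  have : 0 < q := by linarith
  have hquad : (x + q * y) * (x + y) ≤ 7 * (q - 1) * (x ^ 2 + y ^ 2) := by
    nlinarith [sq_nonneg (x - y), mul_pos hx hy, sq_nonneg x, sq_nonneg y]
  calc y / (1 + y ^ 2 / x ^ 2) = y * x ^ 2 / (x ^ 2 + y ^ 2) := by field_simp
    _ ≤ y * x ^ 2 * (7 * (q - 1)) / ((x + q * y) * (x + y)) := by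
        rw [div_le_div_iff₀ (by positivity) (by positivity), mul_assoc (y * x ^ 2)]
        exact mul_le_mul_of_nonneg_left hquad (by positivity)
    _ = 7 * x * (q * y / (x + q * y)) - 7 * x * (y / (x + y)) := by
        field_simp
        ring

theorem sum_dyadic_le {A : ℝ} (hA : 0 < A) (J : ℕ) :
    ∑ j ∈ Finset.range J, √((2 : ℝ) ^ j) / (1 + 2 ^ j / A) ≤ 7 * √A := by
  set x := √A
  have hx : 0 < x := Real.sqrt_pos.2 hA
  set y : ℕ → ℝ := fun j => √(2 ^ j)
  have hy : ∀ j, 0 < y j := fun j => Real.sqrt_pos.2 (by positivity)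
  have hy_succ : ∀ j, y (j + 1) = √2 * y j := fun j => by
    simp only [y, pow_succ', Real.sqrt_mul zero_le_two]
  calc ∑ j ∈ Finset.range J, √((2 : ℝ) ^ j) / (1 + 2 ^ j / A)
      = ∑ j ∈ Finset.range J, y j / (1 + y j ^ 2 / x ^ 2) := by
        refine Finset.sum_congr rfl fun j _ => ?_
        rw [Real.sq_sqrt (by positivity), Real.sq_sqrt hA.le]
    _ ≤ ∑ j ∈ Finset.range J,
          (7 * x * (y (j + 1) / (x + y (j + 1))) - 7 * x * (y j / (x + y j))) := by
        refine Finset.sum_le_sum fun j _ => ?_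
        rw [hy_succ]
        exact div_le_mul_sqrt_two_div_sub hx (hy j)
    _ = 7 * x * (y J / (x + y J)) - 7 * x * (y 0 / (x + y 0)) :=
        Finset.sum_range_sub (fun j => 7 * x * (y j / (x + y j))) J
    _ ≤ 7 * x * 1 - 0 := by
        have := hy J
        have := hy 0
        gcongr
        · exact (div_le_one (by positivity)).2 (by linarith)
        · positivity
    _ = 7 * x := by ring

theorem sum_div_two_pow_log_le {f : ℕ → ℝ} (hf : ∀ j, 0 ≤ f j) {N J : ℕ} (hN : N ≤ 2 ^ J) :
    ∑ i ∈ Finset.Ico 1 N, f (Nat.log 2 i) / 2 ^ Nat.log 2 i ≤ ∑ j ∈ Finset.range J, f j := by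
  have hblock : ∀ j, ∑ i ∈ Finset.Ico (2 ^ j) (2 ^ (j + 1)), f (Nat.log 2 i) / 2 ^ Nat.log 2 i =
      f j := fun j => by
    have hlog : ∀ i ∈ Finset.Ico (2 ^ j) (2 ^ (j + 1)),
        f (Nat.log 2 i) / 2 ^ Nat.log 2 i = f j / 2 ^ j := fun i hi => by
      rw [Finset.mem_Ico] at hi
      rw [Nat.log_eq_of_pow_le_of_lt_pow hi.1 hi.2]
    rw [Finset.sum_congr rfl hlog, Finset.sum_const, Nat.card_Ico, pow_succ, mul_two,
      Nat.add_sub_cancel, nsmul_eq_mul, Nat.cast_pow, Nat.cast_ofNat,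
      mul_div_cancel₀ _ (by positivity)]
  calc ∑ i ∈ Finset.Ico 1 N, f (Nat.log 2 i) / 2 ^ Nat.log 2 i
      ≤ ∑ i ∈ Finset.Ico (2 ^ 0) (2 ^ J), f (Nat.log 2 i) / 2 ^ Nat.log 2 i :=
        Finset.sum_le_sum_of_subset_of_nonneg (Finset.Ico_subset_Ico_right hN)
          fun i _ _ => div_nonneg (hf _) (by positivity)
    _ = ∑ j ∈ Finset.range J, f j := by
        clear hN
        induction J with
        | zero => simp
        | succ J ih =>
          rw [← Finset.sum_Ico_consecutive _ (Nat.pow_le_pow_right two_pos J.zero_le)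
            (Nat.pow_le_pow_right two_pos J.le_succ), ih, hblock, Finset.sum_range_succ]

theorem exp_neg_max_log_le {A m : ℝ} (hA : 0 < A) (hm : 0 < m) :
    Real.exp (-max (Real.log (A / (2 * m))) 0) ≤ 4 / A * (m / (1 + m / A)) := by
  have hrhs : 4 / A * (m / (1 + m / A)) = 4 * m / (A + m) := by field_simp
  rw [hrhs, le_div_iff₀ (by positivity)]
  rcases le_total m A with h | h
  · have hexp : Real.exp (-max (Real.log (A / (2 * m))) 0) ≤ 2 * m / A := by
      refine (Real.exp_le_exp.2 (neg_le_neg (le_max_left _ _))).trans_eq ?_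
      rw [← Real.log_inv, Real.exp_log (by positivity), inv_div]
    calc _ ≤ 2 * m / A * (A + A) := by gcongr
      _ = 4 * m := by field_simp; ring
  · have hexp : Real.exp (-max (Real.log (A / (2 * m))) 0) ≤ 1 :=
      Real.exp_le_one_iff.2 (neg_nonpos.2 (le_max_right _ _))
    calc _ ≤ 1 * (m + m) := by gcongr
      _ ≤ 4 * m := by linarith

end Sums

/-! ### The gap of the arm that MOSS selects -/

section Moss

variable {K n s₀ τ : ℕ} {E : Environment K} {ρ : Policy K}

/-- All selections of the history are possible selections of MOSS restarted every `τ` slots. -/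
def IsMossHistory (τ : ℕ) : {n : ℕ} → History K n → Prop
  | 0, _ => True
  | n + 1, h => IsMossHistory τ (Fin.init h : History K n) ∧
      IsMossChoice τ (Fin.init h : History K n) (h (Fin.last n)).1

theorem isMossHistory_extend (h : History K n) (o : Fin K × ℝ) :
    IsMossHistory τ (extend (h, o)) ↔ IsMossHistory τ h ∧ IsMossChoice τ h o.1 := by
  rw [IsMossHistory, init_extend, extend_last]

theorem measurableSet_isMossChoice_fst :
    MeasurableSet {p : History K n × (Fin K × ℝ) | IsMossChoice τ p.1 p.2.1} := by
  have hunion : {p : History K n × (Fin K × ℝ) | IsMossChoice τ p.1 p.2.1} =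
      ⋃ k, {h : History K n | IsMossChoice τ h k} ×ˢ (Prod.fst ⁻¹' {k}) := by
    ext p
    simp
  rw [hunion]
  exact MeasurableSet.iUnion fun k => (measurableSet_isMossChoice τ k).prod
    (measurable_fst (measurableSet_singleton k))

theorem measurableSet_isMossHistory : MeasurableSet {h : History K n | IsMossHistory τ h} := by
  induction n with
  | zero => exact MeasurableSet.const _
  | succ n ih =>
    exact (measurable_init ih).inter
      ((measurable_init.prodMk (measurable_pi_apply _)) measurableSet_isMossChoice_fst)

theorem IsResettingMoss.ae_isMossHistory (hρ : IsResettingMoss ρ τ) (n : ℕ) :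
    ∀ᵐ h ∂(historyLaw E ρ n), IsMossHistory τ h := by
  induction n with
  | zero => exact ae_of_all _ fun _ => trivial
  | succ n ih =>
    rw [historyLaw, ae_map_iff measurable_extend.aemeasurable measurableSet_isMossHistory,
      Measure.ae_compProd_iff (p := fun p => IsMossHistory τ (extend p))
        (measurable_extend measurableSet_isMossHistory)]
    filter_upwards [ih] with h hh
    have hm : MeasurableSet {o : Fin K × ℝ | IsMossHistory τ (extend (h, o))} :=
      (measurable_extend.comp measurable_prodMk_left) measurableSet_isMossHistory
    rw [stepKernel, Kernel.ae_compProd_iff hm]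
    filter_upwards [hρ n h] with k hk
    exact ae_of_all _ fun x => (isMossHistory_extend h (k, x)).2 ⟨hh, hk⟩

theorem sum_windowCount (s₀ : ℕ) (h : History K n) : ∑ k, windowCount s₀ h k = n - s₀ := by
  induction n with
  | zero => simp [windowCount, windowSamples]
  | succ n ih =>
    rw [← extend_init h]
    simp only [windowCount_extend, Finset.sum_add_distrib, ih]
    by_cases hn : s₀ ≤ n
    · simp [hn, Nat.succ_sub hn]
    · simp only [hn, false_and, if_false, Finset.sum_const_zero]
      omega

theorem windowCount_le (s₀ : ℕ) (h : History K n) (k : Fin K) : windowCount s₀ h k ≤ n - s₀ :=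
  (Finset.single_le_sum (f := windowCount s₀ h) (fun _ _ => Nat.zero_le _)
    (Finset.mem_univ k)).trans_eq (sum_windowCount s₀ h)

theorem epochCount_eq_windowCount (hs : τ * (n / τ) = s₀) (h : History K n) (k : Fin K) :
    epochCount τ h k = windowCount s₀ h k := by
  subst hs
  rfl

theorem log_windowCount_lt (hs : τ * (n / τ) = s₀) (hτ : 0 < τ) (h : History K n) {k : Fin K}
    (hN : windowCount s₀ h k ≠ 0) : Nat.log 2 (windowCount s₀ h k) < τ := by
  have hn : n < s₀ + τ := by simpa only [mul_add, hs, mul_one] using Nat.lt_mul_div_succ n hτ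
  have hcount := windowCount_le s₀ h k
  have hlog := Nat.log_lt_self 2 hN
  omega

theorem mossIndex_eq (hs : τ * (n / τ) = s₀) (h : History K n) (k : Fin K) :
    mossIndex τ h k = epochMean τ h k + bonus (τ / K) (windowCount s₀ h k) := by
  rw [mossIndex, bonus, epochCount_eq_windowCount hs, div_div]

theorem sum_windowSamples_eq (h : History K n) (k : Fin K) :
    ∑ s ∈ windowSamples s₀ h k, (h s).2 =
      cumul s₀ (noise E k) h + ∑ s ∈ windowSamples s₀ h k, mean E s k := by
  simp only [windowSamples, cumul, Finset.sum_filter, ← Finset.sum_add_distrib, noise, ite_and]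
  refine Finset.sum_congr rfl fun s _ => ?_
  split_ifs <;> simp

theorem abs_epochMean_sub_le (hs : τ * (n / τ) = s₀) (h : History K n) (k : Fin K)
    {v V : ℝ} (hV : ∀ t, s₀ ≤ t → t < n → |mean E t k - v| ≤ V) (hN : windowCount s₀ h k ≠ 0) :
    |epochMean τ h k - (v + cumul s₀ (noise E k) h / windowCount s₀ h k)| ≤ V := by
  have hN0 : (0 : ℝ) < windowCount s₀ h k := Nat.cast_pos.2 (Nat.pos_of_ne_zero hN)
  have hmean : epochMean τ h k = (∑ s ∈ windowSamples s₀ h k, (h s).2) / windowCount s₀ h k := by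
    subst hs
    rfl
  have hdiff : epochMean τ h k - (v + cumul s₀ (noise E k) h / windowCount s₀ h k) =
      (∑ s ∈ windowSamples s₀ h k, (mean E s k - v)) / windowCount s₀ h k := by
    rw [hmean, sum_windowSamples_eq (E := E), Finset.sum_sub_distrib, Finset.sum_const,
      nsmul_eq_mul, ← windowCount]
    field_simp
    ring
  rw [hdiff, abs_div, abs_of_pos hN0, div_le_iff₀ hN0]
  calc |∑ s ∈ windowSamples s₀ h k, (mean E s k - v)|
      ≤ ∑ s ∈ windowSamples s₀ h k, |mean E s k - v| := Finset.abs_sum_le_sum_abs _ _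
    _ ≤ (windowSamples s₀ h k).card • V :=
        Finset.sum_le_card_nsmul _ _ V fun s hsk => hV s (Finset.mem_filter.1 hsk).2.1 s.2
    _ = V * windowCount s₀ h k := by rw [nsmul_eq_mul, mul_comm, windowCount]

theorem mul_cumul_noise_div_windowCount_le {σ m θ : ℝ} (hσ : σ ^ 2 = 1) (hm : 0 < m) (hθ : 0 ≤ θ)
    (h : History K n) {k : Fin K} (h₁ : m ≤ windowCount s₀ h k)
    (h₂ : windowCount s₀ h k ≤ 2 * m) :
    σ * (cumul s₀ (noise E k) h / windowCount s₀ h k) ≤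
      m * θ / windowCount s₀ h k + excess E s₀ k σ m θ h / m := by
  have hN : (0 : ℝ) < windowCount s₀ h k := hm.trans_le h₁
  have hexc : 0 ≤ excess E s₀ k σ m θ h := excess_nonneg hm hθ h
  calc σ * (cumul s₀ (noise E k) h / windowCount s₀ h k)
      = σ * cumul s₀ (noise E k) h / windowCount s₀ h k := by ring
    _ ≤ (m * θ + excess E s₀ k σ m θ h) / windowCount s₀ h k := by
        gcongr
        exact mul_cumul_noise_le hσ hm hθ h h₂
    _ = m * θ / windowCount s₀ h k + excess E s₀ k σ m θ h / windowCount s₀ h k := add_div _ _ _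
    _ ≤ m * θ / windowCount s₀ h k + excess E s₀ k σ m θ h / m := by gcongr

theorem two_pow_log_le {N : ℕ} (hN : N ≠ 0) : (2 : ℝ) ^ Nat.log 2 N ≤ N :=
  mod_cast Nat.pow_log_le_self 2 hN

theorem le_two_mul_two_pow_log (N : ℕ) : (N : ℝ) ≤ 2 * 2 ^ Nat.log 2 N := by
  rw [← pow_succ']
  exact_mod_cast (Nat.lt_pow_succ_log_self one_lt_two N).le

/-- The excess of the noise sum of arm `k` at sample sizes from `2 ^ l` to `2 ^ (l + 1)` over a
deviation of the empirical mean by `1 / √A`. -/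
noncomputable def overshoot (E : Environment K) (s₀ : ℕ) (A : ℝ) (k : Fin K) (l : ℕ)
    (h : History K n) : ℝ :=
  excess E s₀ k 1 (2 ^ l) (1 / √A) h

/-- The excess of the negative noise sum of arm `k` at sample sizes from `2 ^ l` to `2 ^ (l + 1)`
over a deviation of the empirical mean by the smallest exploration bonus at these sizes. -/
noncomputable def undershoot (E : Environment K) (s₀ : ℕ) (A : ℝ) (k : Fin K) (l : ℕ)
    (h : History K n) : ℝ :=
  excess E s₀ k (-1) (2 ^ l) √(max (Real.log (A / (2 * 2 ^ l))) 0 / 2 ^ l) h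

variable {A : ℝ} {k : Fin K}

theorem overshoot_nonneg (l : ℕ) (h : History K n) : 0 ≤ overshoot E s₀ A k l h :=
  excess_nonneg (by positivity) (by positivity) h

theorem undershoot_nonneg (l : ℕ) (h : History K n) : 0 ≤ undershoot E s₀ A k l h :=
  excess_nonneg (by positivity) (by positivity) h

theorem overshoot_le_extend (l : ℕ) (h : History K n) (o : Fin K × ℝ) :
    overshoot E s₀ A k l h ≤ overshoot E s₀ A k l (extend (h, o)) :=
  excess_le_extend (by positivity) (by positivity) h o

theorem undershoot_le_extend (l : ℕ) (h : History K n) (o : Fin K × ℝ) :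
    undershoot E s₀ A k l h ≤ undershoot E s₀ A k l (extend (h, o)) :=
  excess_le_extend (by positivity) (by positivity) h o

theorem cumul_noise_div_windowCount_le (h : History K n) {N : ℕ} (hk : windowCount s₀ h k = N)
    (hN : N ≠ 0) :
    cumul s₀ (noise E k) h / N ≤ 1 / √A + overshoot E s₀ A k (Nat.log 2 N) h / 2 ^ Nat.log 2 N := by
  subst hk
  have hdev := mul_cumul_noise_div_windowCount_le (E := E) (σ := 1) (θ := 1 / √A) (by norm_num)
    (by positivity) (by positivity) h (two_pow_log_le hN) (le_two_mul_two_pow_log _)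
  rw [one_mul, mul_div_right_comm] at hdev
  refine hdev.trans (add_le_add_left (mul_le_of_le_one_left (by positivity) ?_) _)
  exact div_le_one_of_le₀ (two_pow_log_le hN) (by positivity)

theorem mul_sqrt_div_le {m N : ℝ} (hA : 0 < A) (hm : 0 < m) (h₁ : m ≤ N) (h₂ : N ≤ 2 * m) :
    m * √(max (Real.log (A / (2 * m))) 0 / m) / N ≤ √(max (Real.log (A / N)) 0 / N) := by
  have hN : 0 < N := hm.trans_le h₁
  refine Real.le_sqrt_of_sq_le ?_
  rw [div_pow, mul_pow, Real.sq_sqrt (by positivity)]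
  calc m ^ 2 * (max (Real.log (A / (2 * m))) 0 / m) / N ^ 2
      = m / N * (max (Real.log (A / (2 * m))) 0 / N) := by field_simp
    _ ≤ 1 * (max (Real.log (A / N)) 0 / N) := by
        gcongr
        exact (div_le_one hN).2 h₁
    _ = max (Real.log (A / N)) 0 / N := one_mul _

theorem neg_cumul_noise_div_windowCount_le (hA : 0 < A) (h : History K n) {N : ℕ}
    (hk : windowCount s₀ h k = N) (hN : N ≠ 0) :
    -(cumul s₀ (noise E k) h / N) ≤
      bonus A N + undershoot E s₀ A k (Nat.log 2 N) h / 2 ^ Nat.log 2 N := by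
  subst hk
  have hdev := mul_cumul_noise_div_windowCount_le (E := E) (σ := -1)
    (θ := √(max (Real.log (A / (2 * 2 ^ Nat.log 2 (windowCount s₀ h k)))) 0 /
      2 ^ Nat.log 2 (windowCount s₀ h k))) (by norm_num)
    (by positivity) (by positivity) h (two_pow_log_le hN) (le_two_mul_two_pow_log _)
  rw [neg_one_mul] at hdev
  exact hdev.trans (add_le_add_left (mul_sqrt_div_le hA (by positivity) (two_pow_log_le hN)
    (le_two_mul_two_pow_log _)) _)

theorem sub_le_of_mossIndex_le {V : ℝ} (hA : A = τ / K) (hA0 : 0 < A) (hs : τ * (n / τ) = s₀)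
    (h : History K n) {j : Fin K} {v : Fin K → ℝ} {M N : ℕ}
    (hV : ∀ t, s₀ ≤ t → t < n → ∀ i, |mean E t i - v i| ≤ V)
    (hj : windowCount s₀ h j = M) (hM : M ≠ 0) (hk : windowCount s₀ h k = N) (hN : N ≠ 0)
    (hi : mossIndex τ h j ≤ mossIndex τ h k) :
    v j - v k ≤ 2 * V + 1 / √A + undershoot E s₀ A j (Nat.log 2 M) h / 2 ^ Nat.log 2 M +
      (bonus A N + overshoot E s₀ A k (Nat.log 2 N) h / 2 ^ Nat.log 2 N) := by
  have hmk := (abs_le.1 (abs_epochMean_sub_le hs h k (fun t a b => hV t a b k) (hk ▸ hN))).2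
  have hmj := (abs_le.1 (abs_epochMean_sub_le hs h j (fun t a b => hV t a b j) (hj ▸ hM))).1
  rw [mossIndex_eq hs, mossIndex_eq hs, ← hA, hk, hj] at hi
  rw [hk] at hmk
  rw [hj] at hmj
  have hnk := cumul_noise_div_windowCount_le (E := E) (A := A) h hk hN
  have hnj := neg_cumul_noise_div_windowCount_le (E := E) hA0 h hj hM
  linarith

/-- A bound for the part of the gap that is due to the selected arm when it is selected with `i`
samples, where `U` bounds its overshoots. -/
noncomputable def sampleCost (b A : ℝ) (U : ℕ → ℝ) (i : ℕ) : ℝ :=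
  if i = 0 then b else bonus A i + U (Nat.log 2 i) / 2 ^ Nat.log 2 i

theorem gap_le_of_isMossChoice {a b V Z : ℝ} {T : ℕ} {U : ℕ → ℝ} (hE : IsSubGaussianEnv E a b T)
    (hτ : 0 < τ) (hA : A = τ / K) (hs : τ * (n / τ) = s₀) (hn : n < T)
    (hV : ∀ t, s₀ ≤ t → t ≤ n → ∀ i, |mean E t i - mean E s₀ i| ≤ V)
    {j : Fin K} (hj : ∀ i, mean E s₀ i ≤ mean E s₀ j) (h : History K n)
    (hU : ∀ l, overshoot E s₀ A k l h ≤ U l)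
    (hZ : ∑ l ∈ Finset.range τ, undershoot E s₀ A j l h / 2 ^ l ≤ Z) (hk : IsMossChoice τ h k) :
    bestMean E n - mean E n k ≤
      4 * V + 1 / √A + Z + sampleCost b A U (windowCount s₀ h k) := by
  have hs₀ : s₀ ≤ n := hs ▸ Nat.mul_div_le n τ
  have hV0 : 0 ≤ V := (abs_nonneg _).trans (hV n hs₀ le_rfl k)
  have hu : ∀ l, 0 ≤ undershoot E s₀ A j l h / 2 ^ l := fun l =>
    div_nonneg (undershoot_nonneg l h) (by positivity)
  have hZ0 : 0 ≤ Z := (Finset.sum_nonneg fun l _ => hu l).trans hZ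
  simp only [IsMossChoice, epochCount_eq_windowCount hs] at hk
  rcases eq_or_ne (windowCount s₀ h k) 0 with hN | hN
  · have hgap := hE.gap_le hn k
    have hA' : 0 ≤ 1 / √A := by positivity
    rw [hN, sampleCost, if_pos rfl]
    linarith
  obtain ⟨hall, hmax⟩ := hk.resolve_left hN
  have : Nonempty (Fin K) := ⟨k⟩
  have hA0 : 0 < A := by
    have : 0 < K := k.pos
    rw [hA]
    positivity
  have hundershoot := (Finset.single_le_sum (fun l _ => hu l)
    (Finset.mem_range.2 (log_windowCount_lt hs hτ h (hall j)))).trans hZ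
  have hovershoot : overshoot E s₀ A k (Nat.log 2 (windowCount s₀ h k)) h /
      2 ^ Nat.log 2 (windowCount s₀ h k) ≤ U (Nat.log 2 (windowCount s₀ h k)) /
      2 ^ Nat.log 2 (windowCount s₀ h k) := by
    gcongr
    exact hU _
  have hindex := sub_le_of_mossIndex_le hA hA0 hs h (fun t h₁ h₂ => hV t h₁ h₂.le) rfl (hall j)
    rfl hN (hmax j)
  have hbest : bestMean E n ≤ mean E s₀ j + V :=
    ciSup_le fun i => by linarith [(abs_le.1 (hV n hs₀ le_rfl i)).2, hj i]
  have hmean := (abs_le.1 (hV n hs₀ le_rfl k)).1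
  rw [sampleCost, if_neg hN]
  linarith

end Moss

/-! ### The regret of MOSS in one epoch -/

section Epoch

variable {K n s₀ τ d T : ℕ} {E : Environment K} {ρ : Policy K} {a b A V : ℝ}

theorem sum_sum_windowCount_extend (hn : s₀ ≤ n) (c : Fin K → ℕ → ℝ) (h : History K n)
    (o : Fin K × ℝ) :
    ∑ k, ∑ i ∈ Finset.range (windowCount s₀ (extend (h, o)) k), c k i =
      ∑ k, ∑ i ∈ Finset.range (windowCount s₀ h k), c k i + c o.1 (windowCount s₀ h o.1) := by
  have hterm : ∀ k, ∑ i ∈ Finset.range (windowCount s₀ (extend (h, o)) k), c k i =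
      ∑ i ∈ Finset.range (windowCount s₀ h k), c k i +
        if o.1 = k then c k (windowCount s₀ h k) else 0 := fun k => by
    simp only [windowCount_extend, hn, true_and]
    split_ifs
    · exact Finset.sum_range_succ _ _
    · rw [add_zero, add_zero]
  simp only [hterm, Finset.sum_add_distrib, Finset.sum_ite_eq, Finset.mem_univ, if_true]

theorem cumul_gap_le_of_isMossHistory {i : ℕ} {Z : ℝ} {U : Fin K → ℕ → ℝ}
    (hE : IsSubGaussianEnv E a b T) (hA : A = τ / K) (hs₀ : s₀ = τ * i)
    (hV : ∀ t, s₀ ≤ t → t < s₀ + τ → t < T → ∀ k, |mean E t k - mean E s₀ k| ≤ V)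
    {j : Fin K} (hj : ∀ k, mean E s₀ k ≤ mean E s₀ j) (hd : d ≤ τ) (hT : s₀ + d ≤ T)
    (h : History K (s₀ + d)) (hh : IsMossHistory τ h) (hU : ∀ k l, overshoot E s₀ A k l h ≤ U k l)
    (hZ : ∑ l ∈ Finset.range τ, undershoot E s₀ A j l h / 2 ^ l ≤ Z) :
    cumul s₀ (gap E) h ≤ d * (4 * V + 1 / √A + Z) +
      ∑ k, ∑ i ∈ Finset.range (windowCount s₀ h k), sampleCost b A (U k) i := by
  induction d with
  | zero =>
    have hcount : ∀ k, windowCount s₀ h k = 0 := fun k => by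
      simpa using windowCount_le s₀ h k
    simp [cumul_of_le, hcount]
  | succ d ih =>
    obtain ⟨g, o, rfl⟩ : ∃ (g : History K (s₀ + d)) (o : Fin K × ℝ), h = extend (g, o) :=
      ⟨_, _, (extend_init (n := s₀ + d) h).symm⟩
    obtain ⟨hg, ho⟩ := (isMossHistory_extend g o).1 hh
    have hs : τ * ((s₀ + d) / τ) = s₀ := by
      rw [hs₀, Nat.mul_add_div (by omega), Nat.div_eq_of_lt hd, add_zero]
    have hUg : ∀ k l, overshoot E s₀ A k l g ≤ U k l := fun k l =>
      (overshoot_le_extend l g o).trans (hU k l)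
    have hZg : ∑ l ∈ Finset.range τ, undershoot E s₀ A j l g / 2 ^ l ≤ Z := by
      refine (Finset.sum_le_sum fun l _ => ?_).trans hZ
      gcongr
      exact undershoot_le_extend l g o
    have hpast := ih (by omega) (by omega) g hg hUg hZg
    have hnow := gap_le_of_isMossChoice hE (by omega) hA hs (by omega)
      (fun t h₁ h₂ => hV t h₁ (by omega) (by omega)) hj g (hUg o.1) hZg ho
    rw [cumul_extend, if_pos (Nat.le_add_right _ _), gap,
      sum_sum_windowCount_extend (Nat.le_add_right _ _)]
    push_cast
    linarith

theorem sum_sampleCost_le (hA : 0 ≤ A) {U : ℕ → ℝ} (hU : ∀ l, 0 ≤ U l) {N J : ℕ} (hN : N ≤ 2 ^ J) :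
    ∑ i ∈ Finset.range N, sampleCost b A U i ≤
      b * (if N = 0 then 0 else 1) + 6 * √A + ∑ l ∈ Finset.range J, U l := by
  rcases N with - | N
  · have hsum : 0 ≤ ∑ l ∈ Finset.range J, U l := Finset.sum_nonneg fun l _ => hU l
    simp only [Finset.range_zero, Finset.sum_empty, if_true, mul_zero, zero_add]
    exact add_nonneg (by positivity) hsum
  have hpos : ∀ i ∈ Finset.Ico 1 (N + 1),
      sampleCost b A U i = bonus A i + U (Nat.log 2 i) / 2 ^ Nat.log 2 i := fun i hi =>
    if_neg (Nat.one_le_iff_ne_zero.1 (Finset.mem_Ico.1 hi).1)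
  rw [Finset.range_eq_Ico, Finset.sum_eq_sum_Ico_succ_bot N.succ_pos, Finset.sum_congr rfl hpos,
    Finset.sum_add_distrib, sampleCost, if_pos rfl, if_neg N.succ_ne_zero, mul_one]
  linarith [sum_bonus_le hA (N + 1), sum_div_two_pow_log_le hU hN]

theorem sum_used_le_sqrt (s₀ : ℕ) (h : History K n) :
    ∑ k, (if windowCount s₀ h k = 0 then (0 : ℝ) else 1) ≤ √(K * (n - s₀ : ℕ)) := by
  have hterm : ∀ k, (if windowCount s₀ h k = 0 then 0 else 1) ≤ windowCount s₀ h k := fun k => by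
    split_ifs <;> omega
  have hterm' : ∀ k, (if windowCount s₀ h k = 0 then 0 else 1) ≤ 1 := fun k => by
    split_ifs <;> omega
  have hcount : ∑ k, (if windowCount s₀ h k = 0 then 0 else 1) ≤ n - s₀ :=
    (Finset.sum_le_sum fun k _ => hterm k).trans_eq (sum_windowCount s₀ h)
  have hcard : ∑ k, (if windowCount s₀ h k = 0 then 0 else 1) ≤ K :=
    (Finset.sum_le_sum fun k _ => hterm' k).trans_eq (by simp)
  refine Real.le_sqrt_of_sq_le ?_
  rw [sq]
  exact_mod_cast Nat.mul_le_mul hcard hcount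

theorem sum_sum_sampleCost_le (hb : 0 ≤ b) (hA : 0 ≤ A) (s₀ : ℕ) (h : History K n) {J : ℕ}
    (hJ : n - s₀ ≤ J) :
    ∑ k, ∑ i ∈ Finset.range (windowCount s₀ h k),
        sampleCost b A (fun l => overshoot E s₀ A k l h) i ≤
      b * √(K * J) + 6 * (K * √A) + ∑ k, ∑ l ∈ Finset.range J, overshoot E s₀ A k l h := by
  have hcount : ∀ k, windowCount s₀ h k ≤ 2 ^ J := fun k =>
    ((windowCount_le s₀ h k).trans hJ).trans Nat.lt_two_pow_self.le
  have hused : ∑ k, (if windowCount s₀ h k = 0 then (0 : ℝ) else 1) ≤ √(K * J) :=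
    (sum_used_le_sqrt s₀ h).trans (by gcongr)
  calc _ ≤ ∑ k, (b * (if windowCount s₀ h k = 0 then 0 else 1) + 6 * √A +
          ∑ l ∈ Finset.range J, overshoot E s₀ A k l h) :=
        Finset.sum_le_sum fun k _ =>
          sum_sampleCost_le hA (fun l => overshoot_nonneg l h) (hcount k)
    _ = b * ∑ k, (if windowCount s₀ h k = 0 then 0 else 1) + 6 * (K * √A) +
          ∑ k, ∑ l ∈ Finset.range J, overshoot E s₀ A k l h := by
        rw [Finset.sum_add_distrib, Finset.sum_add_distrib, ← Finset.mul_sum, Finset.sum_const,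
          Finset.card_univ, Fintype.card_fin, nsmul_eq_mul]
        ring
    _ ≤ _ := by gcongr

theorem IsSubGaussianEnv.integrable_overshoot (hE : IsSubGaussianEnv E a b T) (hn : n ≤ T)
    (k : Fin K) (l : ℕ) :
    Integrable (fun h : History K n => overshoot E s₀ A k l h) (historyLaw E ρ n) :=
  integrable_excess fun t _ ht j => (hE t (ht.trans_le hn) j).1

theorem IsSubGaussianEnv.integrable_undershoot (hE : IsSubGaussianEnv E a b T) (hn : n ≤ T)
    (k : Fin K) (l : ℕ) :
    Integrable (fun h : History K n => undershoot E s₀ A k l h) (historyLaw E ρ n) :=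
  integrable_excess fun t _ ht j => (hE t (ht.trans_le hn) j).1

theorem IsSubGaussianEnv.sum_integral_overshoot_le (hE : IsSubGaussianEnv E a b T) (hn : n ≤ T)
    (hA : 0 < A) (k : Fin K) (J : ℕ) :
    ∑ l ∈ Finset.range J, ∫ h : History K n, overshoot E s₀ A k l h ∂(historyLaw E ρ n) ≤
      11 * √A := by
  have hterm : ∀ l, ∫ h : History K n, overshoot E s₀ A k l h ∂(historyLaw E ρ n) ≤
      3 / 2 * (√(2 ^ l) / (1 + 2 ^ l / A)) := fun l => by
    refine (integral_excess_le (fun t _ ht j => (hE t (ht.trans_le hn) j).1) (by positivity)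
      (by positivity)).trans ?_
    rw [div_eq_mul_inv (√((2 : ℝ) ^ l)), Real.exp_neg, div_pow, one_pow, Real.sq_sqrt hA.le,
      mul_one_div]
    gcongr
    linarith [Real.add_one_le_exp ((2 : ℝ) ^ l / A)]
  calc _ ≤ ∑ l ∈ Finset.range J, 3 / 2 * (√(2 ^ l) / (1 + 2 ^ l / A)) :=
        Finset.sum_le_sum fun l _ => hterm l
    _ ≤ 3 / 2 * (7 * √A) := by
        rw [← Finset.mul_sum]
        gcongr
        exact sum_dyadic_le hA J
    _ ≤ 11 * √A := by linarith [Real.sqrt_nonneg A]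

theorem IsSubGaussianEnv.sum_integral_undershoot_le (hE : IsSubGaussianEnv E a b T) (hn : n ≤ T)
    (hA : 0 < A) (k : Fin K) (J : ℕ) :
    ∑ l ∈ Finset.range J, (∫ h : History K n, undershoot E s₀ A k l h ∂(historyLaw E ρ n)) / 2 ^ l ≤
      42 / √A := by
  have hterm : ∀ l, (∫ h : History K n, undershoot E s₀ A k l h ∂(historyLaw E ρ n)) / 2 ^ l ≤
      6 / A * (√(2 ^ l) / (1 + 2 ^ l / A)) := fun l => by
    rw [div_le_iff₀ (by positivity)]
    refine (integral_excess_le (fun t _ ht j => (hE t (ht.trans_le hn) j).1) (by positivity)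
      (by positivity)).trans ?_
    rw [Real.sq_sqrt (by positivity), mul_div_cancel₀ _ (by positivity)]
    calc _ ≤ 3 / 2 * (√((2 : ℝ) ^ l) * (4 / A * (2 ^ l / (1 + 2 ^ l / A)))) := by
          gcongr
          exact exp_neg_max_log_le hA (by positivity)
      _ = 6 / A * (√(2 ^ l) / (1 + 2 ^ l / A)) * 2 ^ l := by ring
  calc _ ≤ ∑ l ∈ Finset.range J, 6 / A * (√(2 ^ l) / (1 + 2 ^ l / A)) :=
        Finset.sum_le_sum fun l _ => hterm l
    _ ≤ 6 / A * (7 * √A) := by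
        rw [← Finset.mul_sum]
        gcongr
        exact sum_dyadic_le hA J
    _ = 42 * (√A / A) := by ring
    _ = 42 / √A := by rw [Real.sqrt_div_self', mul_one_div]

theorem integral_le_of_ae_le_overshoot {X : History K n → ℝ} {c v : ℝ}
    (hE : IsSubGaussianEnv E a b T) (hn : n ≤ T) (hA : 0 < A) (hv : 0 ≤ v)
    (hX : Integrable X (historyLaw E ρ n)) (j : Fin K) (J : ℕ)
    (hle : ∀ᵐ h ∂(historyLaw E ρ n), X h ≤ c +
      v * ∑ l ∈ Finset.range J, undershoot E s₀ A j l h / 2 ^ l +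
        ∑ k, ∑ l ∈ Finset.range J, overshoot E s₀ A k l h) :
    ∫ h, X h ∂(historyLaw E ρ n) ≤ c + v * (42 / √A) + K * (11 * √A) := by
  have hunder : ∀ l ∈ Finset.range J, Integrable
      (fun h : History K n => undershoot E s₀ A j l h / 2 ^ l) (historyLaw E ρ n) := fun l _ =>
    (hE.integrable_undershoot hn j l).div_const _
  have hover : ∀ k, ∀ l ∈ Finset.range J, Integrable
      (fun h : History K n => overshoot E s₀ A k l h) (historyLaw E ρ n) := fun k l _ =>
    hE.integrable_overshoot hn k l
  have hunderSum := (integrable_finsetSum _ hunder).const_mul v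
  have hoverSum := integrable_finsetSum Finset.univ fun k _ => integrable_finsetSum _ (hover k)
  refine (integral_mono_ae hX (((integrable_const c).add hunderSum).add hoverSum) hle).trans ?_
  rw [integral_add' ((integrable_const c).add hunderSum) hoverSum,
    integral_add' (integrable_const c) hunderSum, integral_const_mul, integral_const,
    probReal_univ, one_smul, integral_finsetSum _ hunder,
    integral_finsetSum _ fun k _ => integrable_finsetSum _ (hover k)]
  simp only [integral_div]
  gcongr
  · exact hE.sum_integral_undershoot_le hn hA j J
  · calc _ ≤ ∑ _k : Fin K, 11 * √A := by
          refine Finset.sum_le_sum fun k _ => ?_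
          rw [integral_finsetSum _ (hover k)]
          exact hE.sum_integral_overshoot_le hn hA k J
      _ = K * (11 * √A) := by simp

theorem mul_sqrt_div_self {x y : ℝ} (hx : 0 < x) (hy : 0 < y) : x * √(y / x) = √(x * y) := by
  rw [← Real.sqrt_sq hx.le, ← Real.sqrt_mul (sq_nonneg x), Real.sqrt_sq hx.le]
  congr 1
  field_simp

theorem sum_slotRegret_epoch_le {i : ℕ} (hK : 0 < K) (hτ : 0 < τ) (hb : 0 ≤ b)
    (hE : IsSubGaussianEnv E a b T) (hρ : IsResettingMoss ρ τ) (hV0 : 0 ≤ V)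
    (hs₀ : s₀ = τ * i)
    (hV : ∀ t, s₀ ≤ t → t < s₀ + τ → t < T → ∀ k, |mean E t k - mean E s₀ k| ≤ V)
    (hd : d ≤ τ) (hT : s₀ + d ≤ T) :
    ∑ t ∈ Finset.Ico s₀ (s₀ + d), slotRegret E ρ t ≤ (b + 60) * √(K * τ) + 4 * V * τ := by
  have : Nonempty (Fin K) := ⟨⟨0, hK⟩⟩
  obtain ⟨j, hj⟩ := Finite.exists_max fun k => mean E s₀ k
  have hK' : (0 : ℝ) < K := Nat.cast_pos.2 hK
  have hτ' : (0 : ℝ) < τ := Nat.cast_pos.2 hτ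
  obtain ⟨A, hA⟩ : ∃ A : ℝ, A = τ / K := ⟨_, rfl⟩
  have hA0 : 0 < A := hA ▸ div_pos hτ' hK'
  have hKA : K * √A = √(K * τ) := hA ▸ mul_sqrt_div_self hK' hτ'
  have hτA : τ * (1 / √A) = √(K * τ) := by
    rw [hA, ← Real.sqrt_one, ← Real.sqrt_div zero_le_one, one_div_div,
      mul_sqrt_div_self hτ' hK', mul_comm]
  have hpath : ∀ᵐ h ∂(historyLaw E ρ (s₀ + d)), cumul s₀ (gap E) h ≤
      τ * (4 * V + 1 / √A) + (b * √(K * τ) + 6 * (K * √A)) +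
        τ * ∑ l ∈ Finset.range τ, undershoot E s₀ A j l h / 2 ^ l +
          ∑ k, ∑ l ∈ Finset.range τ, overshoot E s₀ A k l h := by
    filter_upwards [hρ.ae_isMossHistory (s₀ + d)] with h hh
    have hgap := cumul_gap_le_of_isMossHistory hE hA hs₀ hV hj hd hT h hh (fun _ _ => le_rfl) le_rfl
    have hcost := sum_sum_sampleCost_le (E := E) hb hA0.le s₀ h (J := τ) (by omega)
    have hZ : 0 ≤ ∑ l ∈ Finset.range τ, undershoot E s₀ A j l h / 2 ^ l :=
      Finset.sum_nonneg fun l _ => div_nonneg (undershoot_nonneg l h) (by positivity)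
    have hdτ : (d : ℝ) * (4 * V + 1 / √A + ∑ l ∈ Finset.range τ, undershoot E s₀ A j l h / 2 ^ l) ≤
        τ * (4 * V + 1 / √A + ∑ l ∈ Finset.range τ, undershoot E s₀ A j l h / 2 ^ l) := by
      gcongr
    linarith
  rw [← integral_cumul_gap]
  refine (integral_le_of_ae_le_overshoot hE hT hA0 hτ'.le (integrable_cumul_gap _ _) j τ
    hpath).trans_eq ?_
  linear_combination hτA + 6 * hKA + 42 * hτA + 11 * hKA

end Epoch

/-! ### The regret of Resetting MOSS -/

section UpperBound

variable {K T τ : ℕ} {E : Environment K} {ρ : Policy K} {a b V : ℝ}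

/-- The largest change of a mean reward from slot `t` to slot `t + 1`; the sum of the drifts over
the horizon is the total variation. -/
noncomputable def drift (E : Environment K) (t : ℕ) : ℝ := ⨆ k, |mean E (t + 1) k - mean E t k|

theorem drift_nonneg (t : ℕ) : 0 ≤ drift E t := Real.iSup_nonneg fun _ => abs_nonneg _

theorem variation_eq_sum_drift : variation E T = ∑ t ∈ Finset.range (T - 1), drift E t := rfl

theorem abs_mean_sub_le_sum_drift {s t : ℕ} (hst : s ≤ t) (k : Fin K) :
    |mean E t k - mean E s k| ≤ ∑ u ∈ Finset.Ico s t, drift E u := by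
  induction t, hst using Nat.le_induction with
  | base => simp
  | succ t hst ih =>
    have hlast : |mean E (t + 1) k - mean E t k| ≤ drift E t :=
      le_ciSup (f := fun k => |mean E (t + 1) k - mean E t k|) (Set.finite_range _).bddAbove k
    rw [Finset.sum_Ico_succ_top hst]
    linarith [abs_sub_le (mean E (t + 1) k) (mean E t k) (mean E s k)]

theorem IsSubGaussianEnv.mono {S : ℕ} (hE : IsSubGaussianEnv E a b T) (hST : S ≤ T) :
    IsSubGaussianEnv E a b S := fun t ht => hE t (ht.trans_le hST)

theorem sum_slotRegret_last_epoch_le (hK : 0 < K) (hb : 0 ≤ b)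
    (hE : IsSubGaussianEnv E a b T) (hρ : IsResettingMoss ρ τ) {q : ℕ} (hq : τ * q < T)
    (hT : T ≤ τ * (q + 1)) :
    ∑ t ∈ Finset.Ico (τ * q) T, slotRegret E ρ t ≤
      (b + 60) * √(K * τ) + 4 * (∑ t ∈ Finset.Ico (τ * q) (T - 1), drift E t) * τ := by
  obtain ⟨d, rfl⟩ := Nat.exists_eq_add_of_le hq.le
  rw [mul_add_one] at hT
  refine sum_slotRegret_epoch_le hK (by omega) hb hE hρ
    (Finset.sum_nonneg fun t _ => drift_nonneg t) rfl (fun t hs _ ht k => ?_) (by omega) le_rfl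
  exact (abs_mean_sub_le_sum_drift hs k).trans <|
    Finset.sum_le_sum_of_subset_of_nonneg (Finset.Ico_subset_Ico_right (by omega))
      fun u _ _ => drift_nonneg u

theorem sum_slotRegret_le_of_le_mul (hK : 0 < K) (hb : 0 ≤ b) (hρ : IsResettingMoss ρ τ) {q : ℕ}
    (hE : IsSubGaussianEnv E a b T) (hT : T ≤ τ * q) :
    ∑ t ∈ Finset.range T, slotRegret E ρ t ≤
      q * ((b + 60) * √(K * τ)) + 4 * variation E T * τ := by
  induction q generalizing T with
  | zero =>
    obtain rfl : T = 0 := by omega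
    simp [variation]
  | succ q ih =>
    have hB : 0 ≤ (b + 60) * √(K * τ) := by positivity
    push_cast
    rcases le_or_gt T (τ * q) with hTq | hTq
    · linarith [ih hE hTq]
    · have hpast := ih (hE.mono hTq.le) le_rfl
      have hlast := sum_slotRegret_last_epoch_le hK hb hE hρ hTq hT
      have hvar : variation E (τ * q) + ∑ t ∈ Finset.Ico (τ * q) (T - 1), drift E t ≤
          variation E T := by
        rw [variation_eq_sum_drift, variation_eq_sum_drift,
          ← Finset.sum_range_add_sum_Ico _ (Nat.le_sub_one_of_lt hTq)]
        gcongr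
        · exact fun t _ _ => drift_nonneg t
        · exact Nat.sub_le _ _
      rw [← Finset.sum_range_add_sum_Ico _ hTq.le]
      have := mul_le_mul_of_nonneg_right hvar (Nat.cast_nonneg (α := ℝ) τ)
      linarith

theorem IsSubGaussianEnv.regret_le_of_isResettingMoss (hK : 0 < K) (hτ : 0 < τ) (hb : 0 ≤ b)
    (hE : IsSubGaussianEnv E a b T) (hρ : IsResettingMoss ρ τ) :
    regret E ρ T ≤ (T / τ + 1) * ((b + 60) * √(K * τ)) + 4 * variation E T * τ := by
  have hT : T ≤ τ * (T / τ + 1) := (Nat.lt_mul_div_succ T hτ).le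
  have hdiv : ((T / τ + 1 : ℕ) : ℝ) ≤ T / τ + 1 := by
    push_cast
    linarith [Nat.cast_div_le (α := ℝ) (m := T) (n := τ)]
  calc regret E ρ T = ∑ t ∈ Finset.range T, slotRegret E ρ t := hE.regret_eq_sum
    _ ≤ (T / τ + 1 : ℕ) * ((b + 60) * √(K * τ)) + 4 * variation E T * τ :=
        sum_slotRegret_le_of_le_mul hK hb hρ hE hT
    _ ≤ _ := by gcongr

end UpperBound

/-! ### The optimal rate -/

section Rate

variable {K T : ℕ} {a b V : ℝ} {E : Environment K} {ρ : Policy K}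

/-- The restart period before rounding, `K ^ (1/3) * (T / V) ^ (2/3)`. It balances the regret
`T * √(K / L)` of `T / L` restarts against the cost `L * V` of a variation `V` in epochs of
length `L`. -/
noncomputable def idealPeriod (K T : ℕ) (V : ℝ) : ℝ :=
  (K : ℝ) ^ (1 / 3 : ℝ) * ((T : ℝ) / V) ^ (2 / 3 : ℝ)

/-- The minimax order `(K * V) ^ (1/3) * T ^ (2/3)` of the regret. -/
noncomputable def rate (K T : ℕ) (V : ℝ) : ℝ :=
  ((K : ℝ) * V) ^ (1 / 3 : ℝ) * (T : ℝ) ^ (2 / 3 : ℝ)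

theorem restartPeriod_eq_ceil : restartPeriod K T V = ⌈idealPeriod K T V⌉₊ := rfl

theorem idealPeriod_pos (hK : 0 < K) (hT : 0 < T) (hV : 0 < V) : 0 < idealPeriod K T V := by
  unfold idealPeriod
  positivity

theorem idealPeriod_mul (hV : 0 < V) : idealPeriod K T V * V = rate K T V := by
  have hsplit : V ^ (1 / 3 : ℝ) * V ^ (2 / 3 : ℝ) = V := by
    rw [← Real.rpow_add hV]
    norm_num
  rw [idealPeriod, rate, Real.mul_rpow K.cast_nonneg hV.le, Real.div_rpow T.cast_nonneg hV.le]
  have : 0 < V ^ (2 / 3 : ℝ) := by positivity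
  field_simp
  linear_combination (-(K : ℝ) ^ (1 / 3 : ℝ) * (T : ℝ) ^ (2 / 3 : ℝ)) * hsplit

theorem rate_pow_three (hV : 0 ≤ V) : rate K T V ^ 3 = K * V * T ^ 2 := by
  rw [rate, mul_pow, ← Real.rpow_natCast, ← Real.rpow_natCast ((T : ℝ) ^ (2 / 3 : ℝ)),
    ← Real.rpow_mul (by positivity), ← Real.rpow_mul (by positivity)]
  norm_num

theorem mul_sqrt_div_idealPeriod (hK : 0 < K) (hT : 0 < T) (hV : 0 < V) :
    T * √(K / idealPeriod K T V) = rate K T V := by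
  have hL := idealPeriod_pos hK hT hV
  have hr : 0 < rate K T V := idealPeriod_mul (K := K) (T := T) hV ▸ mul_pos hL hV
  have hL_eq : idealPeriod K T V = rate K T V / V := by
    rw [← idealPeriod_mul hV, mul_div_cancel_right₀ _ hV.ne']
  have hsq : (K : ℝ) / idealPeriod K T V = (rate K T V / T) ^ 2 := by
    rw [hL_eq]
    field_simp
    linear_combination -rate_pow_three hV.le
  rw [hsq, Real.sqrt_sq (by positivity)]
  field_simp

theorem cast_le_rate_of_idealPeriod_le (hK : 0 < K) (hT : 0 < T) (hV : 0 < V)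
    (hL : idealPeriod K T V ≤ K) : T ≤ rate K T V := by
  rw [← mul_sqrt_div_idealPeriod hK hT hV]
  exact le_mul_of_one_le_right T.cast_nonneg <|
    Real.one_le_sqrt.2 <| (one_le_div (idealPeriod_pos hK hT hV)).2 hL

theorem restartPeriod_le_two_mul (hL : 1 ≤ idealPeriod K T V) :
    restartPeriod K T V ≤ 2 * idealPeriod K T V := by
  rw [restartPeriod_eq_ceil]
  linarith [Nat.ceil_lt_add_one (zero_le_one.trans hL)]

theorem div_restartPeriod_add_one_mul_sqrt_le (hK : 0 < K) (hT : 0 < T) (hV : 0 < V)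
    (hτT : restartPeriod K T V ≤ T) :
    ((T : ℝ) / restartPeriod K T V + 1) * √(K * restartPeriod K T V) ≤ 2 * rate K T V := by
  have hL := idealPeriod_pos hK hT hV
  have hLτ : idealPeriod K T V ≤ restartPeriod K T V := Nat.le_ceil _
  have hτ : (0 : ℝ) < restartPeriod K T V := hL.trans_le hLτ
  have hepochs : (T : ℝ) / restartPeriod K T V + 1 ≤ 2 * (T / restartPeriod K T V) := by
    linarith [(one_le_div hτ).2 (Nat.cast_le (α := ℝ).2 hτT)]
  calc _ ≤ 2 * ((T : ℝ) / restartPeriod K T V) * √(K * restartPeriod K T V) := by gcongr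
    _ = 2 * (T * √(K / restartPeriod K T V)) := by
        rw [mul_comm (K : ℝ), ← mul_sqrt_div_self hτ (Nat.cast_pos.2 hK)]
        field_simp
    _ ≤ 2 * (T * √(K / idealPeriod K T V)) := by gcongr
    _ = 2 * rate K T V := by rw [mul_sqrt_div_idealPeriod hK hT hV]

theorem regret_le_rate (hK : 0 < K) (hT : 0 < T) (hV : 0 < V) (hb : 0 ≤ b)
    (hτT : restartPeriod K T V ≤ T) (hρ : IsResettingMoss ρ (restartPeriod K T V))
    (hE : E ∈ envClass K a b V T) :
    regret E ρ T ≤ (2 * b + 128) * rate K T V := by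
  have hr : 0 ≤ rate K T V := by unfold rate; positivity
  rcases le_total (idealPeriod K T V) 1 with hL | hL
  · have hT_le : T ≤ rate K T V :=
      cast_le_rate_of_idealPeriod_le hK hT hV (hL.trans (Nat.one_le_cast.2 hK))
    calc regret E ρ T ≤ b * T := hE.1.regret_le_mul
      _ ≤ b * rate K T V := by gcongr
      _ ≤ (2 * b + 128) * rate K T V := by gcongr; linarith
  · have hτ : 0 < restartPeriod K T V := Nat.ceil_pos.2 (idealPeriod_pos hK hT hV)
    have hepochs := div_restartPeriod_add_one_mul_sqrt_le hK hT hV hτT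
    have hdrift : variation E T * restartPeriod K T V ≤ V * (2 * idealPeriod K T V) :=
      mul_le_mul hE.2 (restartPeriod_le_two_mul hL) (Nat.cast_nonneg _) hV.le
    calc regret E ρ T ≤ (T / restartPeriod K T V + 1) * ((b + 60) * √(K * restartPeriod K T V)) +
          4 * variation E T * restartPeriod K T V :=
          hE.1.regret_le_of_isResettingMoss hK hτ hb hρ
      _ = (b + 60) * ((T / restartPeriod K T V + 1) * √(K * restartPeriod K T V)) +
          4 * (variation E T * restartPeriod K T V) := by ring
      _ ≤ (b + 60) * (2 * rate K T V) + 4 * (V * (2 * idealPeriod K T V)) := by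
          linarith [mul_le_mul_of_nonneg_left hepochs (by positivity : 0 ≤ b + 60)]
      _ = (2 * b + 128) * rate K T V := by
          rw [← idealPeriod_mul hV]
          ring

end Rate

/-! ### Change of measure -/

section ChangeOfMeasure

variable {Ω : Type*} [MeasurableSpace Ω] {μ : Measure Ω} {D f : Ω → ℝ}

theorem integrable_exp_mul_of_withDensity [IsFiniteMeasure
    (μ.withDensity fun ω => ENNReal.ofReal (Real.exp (D ω)))] (hD : Measurable D)
    (hf : Measurable f) {C : ℝ} (hC : ∀ ω, |f ω| ≤ C) :
    Integrable (fun ω => Real.exp (D ω) * f ω) μ := by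
  have hfi : Integrable f (μ.withDensity fun ω => ENNReal.ofReal (Real.exp (D ω))) :=
    Integrable.of_bound hf.aestronglyMeasurable C (ae_of_all _ hC)
  simpa only [smul_eq_mul, ENNReal.toReal_ofReal (Real.exp_nonneg _)] using
    (integrable_withDensity_iff_integrable_smul' hD.exp.ennreal_ofReal
      (ae_of_all _ fun _ => ENNReal.ofReal_lt_top)).1 hfi

theorem integral_withDensity_exp (hD : Measurable D) (f : Ω → ℝ) :
    ∫ ω, f ω ∂(μ.withDensity fun ω => ENNReal.ofReal (Real.exp (D ω))) =
      ∫ ω, Real.exp (D ω) * f ω ∂μ := by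
  simp only [integral_withDensity_eq_integral_toReal_smul hD.exp.ennreal_ofReal
    (ae_of_all _ fun _ => ENNReal.ofReal_lt_top), smul_eq_mul,
    ENNReal.toReal_ofReal (Real.exp_nonneg _)]

/-- A pointwise Pinsker inequality: with `w = exp (D / 2)`, the increment
`(w ^ 2 - 1) * f ≤ |w - 1| * (w + 1)` splits by AM-GM into `4 * (w - 1) ^ 2`, which the entropy
`exp D - 1 - D` controls, and `(w + 1) ^ 2 / 16`. -/
theorem exp_mul_le_add (D : ℝ) {f : ℝ} (h0 : 0 ≤ f) (h1 : f ≤ 1) :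
    Real.exp D * f ≤ f + 8 * (Real.exp D - 1 - D) + (Real.exp D + 1) / 16 := by
  have hw : Real.exp D = Real.exp (D / 2) ^ 2 := by
    rw [← Real.exp_nat_mul]
    congr 1
    push_cast
    ring
  have hexp := Real.add_one_le_exp (D / 2)
  have hpos := Real.exp_pos (D / 2)
  rw [hw]
  generalize Real.exp (D / 2) = w at hexp hpos
  have hincr : (w ^ 2 - 1) * f ≤ |w - 1| * (w + 1) := by
    calc (w ^ 2 - 1) * f ≤ |w ^ 2 - 1| * 1 := by gcongr; exact le_abs_self _
      _ = |w - 1| * (w + 1) := by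
        rw [mul_one, show w ^ 2 - 1 = (w - 1) * (w + 1) by ring, abs_mul,
          abs_of_pos (show 0 < w + 1 by linarith)]
  nlinarith [sq_nonneg (16 * |w - 1| - (w + 1)), sq_nonneg (w - 1), sq_abs (w - 1)]

theorem integral_withDensity_exp_le [IsProbabilityMeasure μ] [IsProbabilityMeasure
    (μ.withDensity fun ω => ENNReal.ofReal (Real.exp (D ω)))] (hD : Measurable D)
    (hDi : Integrable D μ) (hf : Measurable f) (h0 : ∀ ω, 0 ≤ f ω) (h1 : ∀ ω, f ω ≤ 1) :
    ∫ ω, f ω ∂(μ.withDensity fun ω => ENNReal.ofReal (Real.exp (D ω))) ≤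
      ∫ ω, f ω ∂μ - 8 * ∫ ω, D ω ∂μ + 1 / 8 := by
  have habs : ∀ ω, |f ω| ≤ 1 := fun ω => (abs_of_nonneg (h0 ω)).trans_le (h1 ω)
  have hfi : Integrable f μ := Integrable.of_bound hf.aestronglyMeasurable 1 (ae_of_all _ habs)
  have hexp : Integrable (fun ω => Real.exp (D ω)) μ := by
    simpa using integrable_exp_mul_of_withDensity (μ := μ) hD (measurable_const (a := (1 : ℝ)))
      (C := 1) (by simp)
  have hmass : ∫ ω, Real.exp (D ω) ∂μ = 1 := by
    simpa using (integral_withDensity_exp (μ := μ) hD fun _ => 1).symm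
  have hent : Integrable (fun ω => Real.exp (D ω) - 1 - D ω) μ :=
    (hexp.sub (integrable_const 1)).sub hDi
  have hfent : Integrable (fun ω => f ω + 8 * (Real.exp (D ω) - 1 - D ω)) μ :=
    hfi.add (hent.const_mul 8)
  have hsum : Integrable (fun ω => (Real.exp (D ω) + 1) / 16) μ :=
    (hexp.add (integrable_const 1)).div_const 16
  calc _ = ∫ ω, Real.exp (D ω) * f ω ∂μ := integral_withDensity_exp hD f
    _ ≤ ∫ ω, (f ω + 8 * (Real.exp (D ω) - 1 - D ω) + (Real.exp (D ω) + 1) / 16) ∂μ :=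
        integral_mono (integrable_exp_mul_of_withDensity hD hf habs) (hfent.add hsum)
          fun ω => exp_mul_le_add (D ω) (h0 ω) (h1 ω)
    _ = ∫ ω, f ω ∂μ + 8 * (1 - 1 - ∫ ω, D ω ∂μ) + (1 + 1) / 16 := by
        rw [integral_add hfent hsum, integral_add hfi (hent.const_mul 8), integral_const_mul,
          integral_sub (f := fun ω => Real.exp (D ω) - 1) (hexp.sub (integrable_const 1)) hDi,
          integral_sub hexp (integrable_const 1), integral_div,
          integral_add hexp (integrable_const 1), hmass, integral_const, probReal_univ, one_smul]
    _ = _ := by ring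

variable {K n s₀ : ℕ} {E E' : Environment K} {ρ : Policy K} {F : ℕ → Fin K × ℝ → ℝ}

theorem lintegral_stepKernel_withDensity {G g : Fin K × ℝ → ℝ≥0∞} (hG : Measurable G)
    (hE : ∀ k, (E' n k : Measure ℝ) = (E n k : Measure ℝ).withDensity fun x => G (k, x))
    (h : History K n) (hg : Measurable g) :
    ∫⁻ o, g o ∂(stepKernel E' ρ n h) = ∫⁻ o, G o * g o ∂(stepKernel E ρ n h) := by
  rw [lintegral_stepKernel h hg, lintegral_stepKernel h (f := fun o => G o * g o) (hG.mul hg)]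
  refine lintegral_congr fun k => ?_
  rw [hE k]
  exact lintegral_withDensity_eq_lintegral_mul _ (hG.comp measurable_prodMk_left)
    (hg.comp measurable_prodMk_left)

theorem historyLaw_eq_withDensity (hF : ∀ t, Measurable (F t))
    (hE : ∀ t < n, ∀ k, (E' t k : Measure ℝ) = (E t k : Measure ℝ).withDensity fun x =>
      ENNReal.ofReal (Real.exp (if s₀ ≤ t then F t (k, x) else 0))) :
    historyLaw E' ρ n =
      (historyLaw E ρ n).withDensity fun h => ENNReal.ofReal (Real.exp (cumul s₀ F h)) := by
  have hcumul : ∀ m, Measurable fun h : History K m =>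
      ENNReal.ofReal (Real.exp (cumul s₀ F h)) :=
    fun m => (measurable_cumul hF).exp.ennreal_ofReal
  induction n with
  | zero => simp [historyLaw, cumul]
  | succ n ih =>
    have hFn : Measurable fun o => ENNReal.ofReal (Real.exp (if s₀ ≤ n then F n o else 0)) :=
      ((hF n).ite (MeasurableSet.const _) measurable_const).exp.ennreal_ofReal
    refine Measure.ext_of_lintegral _ fun f hf => ?_
    have hfe : Measurable fun p : History K n × (Fin K × ℝ) => f (extend p) :=
      hf.comp measurable_extend
    rw [lintegral_historyLaw_succ hf, ih fun t ht => hE t (ht.trans n.lt_succ_self),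
      lintegral_withDensity_eq_lintegral_mul _ (hcumul _) hfe.lintegral_kernel_prod_right',
      lintegral_withDensity_eq_lintegral_mul _ (hcumul _) hf,
      lintegral_historyLaw_succ ((hcumul _).mul hf)]
    refine lintegral_congr fun h => ?_
    have hfh : Measurable fun o => f (extend (h, o)) := hfe.comp measurable_prodMk_left
    simp only [Pi.mul_apply, cumul_extend]
    rw [lintegral_stepKernel_withDensity hFn (hE n n.lt_succ_self) h hfh]
    refine (lintegral_const_mul _ (hFn.mul hfh)).symm.trans (lintegral_congr fun o => ?_)
    rw [Pi.mul_apply, Real.exp_add, ENNReal.ofReal_mul (Real.exp_nonneg _), mul_assoc]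

theorem integral_ite_eq (μ : Measure (Fin K)) [IsFiniteMeasure μ] (k : Fin K) (c : ℝ) :
    ∫ j, (if j = k then c else 0) ∂μ = μ.real {k} * c := by
  simp [integral_fintype Integrable.of_finite]

theorem integral_windowCount (s₀ n : ℕ) (k : Fin K) :
    ∫ h : History K n, (windowCount s₀ h k : ℝ) ∂(historyLaw E ρ n) =
      ∑ t ∈ Finset.Ico s₀ n, (armLaw E ρ t).real {k} := by
  simp only [windowCount_eq_cumul]
  rw [integral_cumul measurable_armIndicator fun t _ _ j => integrable_const
    (if j = k then (1 : ℝ) else 0)]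
  refine Finset.sum_congr rfl fun t _ => ?_
  have hcond : ∀ j, ∫ x, armIndicator k t (j, x) ∂(E t j : Measure ℝ) =
      if j = k then (1 : ℝ) else 0 := fun j => by by_cases h : j = k <;> simp [armIndicator, h]
  simp only [hcond, integral_ite_eq, mul_one]

theorem sum_armLaw_le_of_withDensity (hF : ∀ t, Measurable (F t))
    (hE : ∀ t < n, ∀ k, (E' t k : Measure ℝ) = (E t k : Measure ℝ).withDensity fun x =>
      ENNReal.ofReal (Real.exp (if s₀ ≤ t then F t (k, x) else 0)))
    (hi : Integrable (fun h : History K n => cumul s₀ F h) (historyLaw E ρ n)) (k : Fin K) :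
    ∑ t ∈ Finset.Ico s₀ n, (armLaw E' ρ t).real {k} ≤
      ∑ t ∈ Finset.Ico s₀ n, (armLaw E ρ t).real {k} +
        (n - s₀ : ℕ) * (1 / 8 - 8 * ∫ h : History K n, cumul s₀ F h ∂(historyLaw E ρ n)) := by
  rcases Nat.eq_zero_or_pos (n - s₀) with hn | hn
  · simp [Finset.Ico_eq_empty_of_le (Nat.sub_eq_zero_iff_le.1 hn), hn]
  have hd : (0 : ℝ) < (n - s₀ : ℕ) := Nat.cast_pos.2 hn
  have hlaw := historyLaw_eq_withDensity (ρ := ρ) hF hE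
  have : IsProbabilityMeasure ((historyLaw E ρ n).withDensity fun h =>
    ENNReal.ofReal (Real.exp (cumul s₀ F h))) := hlaw ▸ inferInstance
  have hcount : Measurable fun h : History K n => (windowCount s₀ h k : ℝ) := by
    simpa only [windowCount_eq_cumul] using measurable_cumul measurable_armIndicator
  have hle := integral_withDensity_exp_le (measurable_cumul hF) hi
    (f := fun h => (windowCount s₀ h k : ℝ) / (n - s₀ : ℕ)) (hcount.div_const _)
    (fun h => by positivity)
    fun h => (div_le_one hd).2 (Nat.cast_le.2 (windowCount_le s₀ h k))
  rw [← hlaw, integral_div, integral_div, integral_windowCount, integral_windowCount,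
    div_le_iff₀ hd] at hle
  refine hle.trans_eq ?_
  field_simp
  ring

end ChangeOfMeasure

/-! ### Two-point rewards -/

section TwoPoint

variable {a ε : ℝ}

/-- The law on `a - 1 / 2` and `a + 1 / 2` with mean `a + ε`, for `|ε| ≤ 1 / 2`; it carries the
rewards of the environments of the lower bound. The projection onto `[0, 1]` only serves to make
the definition total in `ε`. -/
noncomputable def twoPoint (a ε : ℝ) : ProbabilityMeasure ℝ :=
  ⟨bernoulliMeasure (a + 1 / 2) (a - 1 / 2) (Set.projIcc 0 1 zero_le_one (1 / 2 + ε)),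
    inferInstance⟩

theorem coe_twoPoint (a ε : ℝ) : (twoPoint a ε : Measure ℝ) =
    bernoulliMeasure (a + 1 / 2) (a - 1 / 2) (Set.projIcc 0 1 zero_le_one (1 / 2 + ε)) := rfl

theorem coe_projIcc_half_add (hε : |ε| ≤ 1 / 2) :
    (Set.projIcc (0 : ℝ) 1 zero_le_one (1 / 2 + ε) : ℝ) = 1 / 2 + ε := by
  rw [Set.projIcc_of_mem _ ⟨by linarith [neg_abs_le ε], by linarith [le_abs_self ε]⟩]

theorem integrable_twoPoint (f : ℝ → ℝ) : Integrable f (twoPoint a ε : Measure ℝ) :=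
  integrable_bernoulliMeasure _ _ _ f

theorem integral_twoPoint (hε : |ε| ≤ 1 / 2) (f : ℝ → ℝ) :
    ∫ x, f x ∂(twoPoint a ε : Measure ℝ) =
      (1 / 2 + ε) * f (a + 1 / 2) + (1 / 2 - ε) * f (a - 1 / 2) := by
  rw [coe_twoPoint, integral_bernoulliMeasure, coe_projIcc_half_add hε, smul_eq_mul, smul_eq_mul]
  ring

theorem lintegral_twoPoint (hε : |ε| ≤ 1 / 2) (f : ℝ → ℝ≥0∞) :
    ∫⁻ x, f x ∂(twoPoint a ε : Measure ℝ) =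
      ENNReal.ofReal (1 / 2 + ε) * f (a + 1 / 2) + ENNReal.ofReal (1 / 2 - ε) * f (a - 1 / 2) := by
  rw [coe_twoPoint, bernoulliMeasure_def, lintegral_add_measure, lintegral_smul_measure,
    lintegral_smul_measure, lintegral_dirac, lintegral_dirac, ENNReal.smul_def, ENNReal.smul_def,
    smul_eq_mul, smul_eq_mul, ← ENNReal.ofReal_coe_nnreal, ← ENNReal.ofReal_coe_nnreal,
    unitInterval.coe_toNNReal, unitInterval.coe_toNNReal, unitInterval.coe_symm_eq,
    coe_projIcc_half_add hε]
  congr 3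
  ring

theorem integral_id_twoPoint (hε : |ε| ≤ 1 / 2) :
    ∫ x, x ∂(twoPoint a ε : Measure ℝ) = a + ε := by
  rw [integral_twoPoint hε]
  ring

theorem hasSubgaussianMGF_twoPoint (a ε : ℝ) :
    HasSubgaussianMGF (fun x => x - ∫ x, x ∂(twoPoint a ε : Measure ℝ)) (1 / 4)
      (twoPoint a ε : Measure ℝ) := by
  have hsupp : ∀ᵐ x ∂(twoPoint a ε : Measure ℝ), x ∈ Set.Icc (a - 1 / 2) (a + 1 / 2) :=
    (mem_ae_iff_prob_eq_one (measurableSet_Icc (a := a - 1 / 2) (b := a + 1 / 2))).2 <|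
      bernoulliMeasure_apply_of_mem_of_mem _ measurableSet_Icc
        ⟨by linarith, le_rfl⟩ ⟨le_rfl, by linarith⟩
  have hwidth : (‖a + 1 / 2 - (a - 1 / 2)‖₊ / 2) ^ 2 = (1 / 4 : NNReal) := by
    rw [show a + 1 / 2 - (a - 1 / 2) = 1 by ring]
    norm_num
  exact hwidth ▸ hasSubgaussianMGF_of_mem_Icc measurable_id.aemeasurable hsupp

/-- The log-likelihood ratio of `twoPoint a ε` to `twoPoint a 0`. -/
noncomputable def logRatio (a ε x : ℝ) : ℝ :=
  if x = a + 1 / 2 then Real.log (1 + 2 * ε) else Real.log (1 - 2 * ε)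

theorem measurable_logRatio : Measurable (logRatio a ε) :=
  Measurable.ite (measurableSet_singleton _) measurable_const measurable_const

theorem logRatio_add_half (a ε : ℝ) : logRatio a ε (a + 1 / 2) = Real.log (1 + 2 * ε) :=
  if_pos rfl

theorem logRatio_sub_half (a ε : ℝ) : logRatio a ε (a - 1 / 2) = Real.log (1 - 2 * ε) :=
  if_neg (by linarith)

theorem twoPoint_eq_withDensity (hε : |ε| < 1 / 2) :
    (twoPoint a ε : Measure ℝ) = (twoPoint a 0 : Measure ℝ).withDensity fun x =>
      ENNReal.ofReal (Real.exp (logRatio a ε x)) := by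
  obtain ⟨hlo, hhi⟩ := abs_lt.1 hε
  refine Measure.ext_of_lintegral _ fun f hf => ?_
  rw [lintegral_withDensity_eq_lintegral_mul _ measurable_logRatio.exp.ennreal_ofReal hf,
    lintegral_twoPoint hε.le, lintegral_twoPoint (by norm_num)]
  simp only [Pi.mul_apply, logRatio_add_half, logRatio_sub_half, add_zero, sub_zero]
  rw [Real.exp_log (by linarith), Real.exp_log (by linarith), ← mul_assoc, ← mul_assoc,
    ← ENNReal.ofReal_mul (by norm_num), ← ENNReal.ofReal_mul (by norm_num)]
  congr 3 <;> ring

theorem neg_sq_le_integral_logRatio (hε : |ε| ≤ 1 / 4) :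
    -(4 * ε ^ 2) ≤ ∫ x, logRatio a ε x ∂(twoPoint a 0 : Measure ℝ) := by
  obtain ⟨hlo, hhi⟩ := abs_le.1 hε
  have hsq : ε ^ 2 ≤ 1 / 16 := by nlinarith
  have hpos : 0 < 1 - 4 * ε ^ 2 := by linarith
  have hinv : (1 - 4 * ε ^ 2)⁻¹ ≤ 1 + 8 * ε ^ 2 := by
    rw [inv_le_iff_one_le_mul₀ hpos]
    nlinarith [mul_nonneg (sq_nonneg ε) (sub_nonneg.2 hsq)]
  have hlog : Real.log (1 + 2 * ε) + Real.log (1 - 2 * ε) = Real.log (1 - 4 * ε ^ 2) := by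
    rw [← Real.log_mul (by linarith) (by linarith)]
    ring_nf
  rw [integral_twoPoint (by norm_num), logRatio_add_half, logRatio_sub_half]
  linarith [Real.one_sub_inv_le_log_of_pos hpos]

end TwoPoint

/-! ### Hard environments -/

section HardEnv

variable {K : ℕ} {ρ : Policy K} {a b ε : ℝ}

/-- The environment in which all arms have mean `a`, except that the arm `σ t`, if any, has mean
`a + ε` in slot `t`. -/
noncomputable def hardEnv (a ε : ℝ) (σ : ℕ → Option (Fin K)) : Environment K :=
  fun t k => twoPoint a (if σ t = some k then ε else 0)

theorem hardEnv_congr {σ σ' : ℕ → Option (Fin K)} {t : ℕ} (h : σ t = σ' t) :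
    hardEnv a ε σ t = hardEnv a ε σ' t := by
  funext k
  simp only [hardEnv, h]

theorem mean_hardEnv (hε : |ε| ≤ 1 / 2) (σ : ℕ → Option (Fin K)) (t : ℕ) (k : Fin K) :
    mean (hardEnv a ε σ) t k = a + if σ t = some k then ε else 0 := by
  refine integral_id_twoPoint ?_
  split_ifs
  · exact hε
  · norm_num

theorem isSubGaussianEnv_hardEnv (h0 : 0 ≤ ε) (h1 : ε ≤ 1 / 2) (hb : ε ≤ b)
    (σ : ℕ → Option (Fin K)) (T : ℕ) : IsSubGaussianEnv (hardEnv a ε σ) a b T := by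
  refine fun t _ k => ⟨hasSubgaussianMGF_twoPoint _ _, ?_⟩
  rw [mean_hardEnv ((abs_of_nonneg h0).trans_le h1)]
  split_ifs <;> constructor <;> linarith

theorem slotRegret_hardEnv (h0 : 0 ≤ ε) (h1 : ε ≤ 1 / 2) {σ : ℕ → Option (Fin K)} {t : ℕ}
    {k : Fin K} (hk : σ t = some k) :
    slotRegret (hardEnv a ε σ) ρ t = ε * (1 - (armLaw (hardEnv a ε σ) ρ t).real {k}) := by
  have hε : |ε| ≤ 1 / 2 := (abs_of_nonneg h0).trans_le h1
  have hmean : ∀ j, mean (hardEnv a ε σ) t j = a + if j = k then ε else 0 := fun j => by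
    simp only [mean_hardEnv hε, hk, Option.some.injEq, eq_comm]
  have hbest : bestMean (hardEnv a ε σ) t = a + ε := by
    have : Nonempty (Fin K) := ⟨k⟩
    refine le_antisymm (ciSup_le fun j => ?_) ?_
    · rw [hmean]
      split_ifs <;> linarith
    · refine le_trans (le_of_eq ?_) (mean_le_bestMean t k)
      rw [hmean, if_pos rfl]
  simp only [slotRegret, hbest, hmean, add_sub_add_left_eq_sub]
  rw [integral_sub (integrable_const ε) Integrable.of_finite, integral_ite_eq, integral_const,
    probReal_univ, one_smul]
  ring

/-- The best arms `σ` before slot `s`, and the arm `k`, if any, from slot `s` on. -/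
def switchAt (σ : ℕ → Option (Fin K)) (s : ℕ) (k : Option (Fin K)) (t : ℕ) : Option (Fin K) :=
  if t < s then σ t else k

/-- The log-likelihood ratio of an observation when the mean of arm `k` is raised from `a` to
`a + ε`. -/
noncomputable def armLogRatio (a ε : ℝ) (k : Fin K) (o : Fin K × ℝ) : ℝ :=
  if o.1 = k then logRatio a ε o.2 else 0

theorem measurable_armLogRatio (k : Fin K) : Measurable (armLogRatio a ε k) :=
  Measurable.ite (measurable_fst (measurableSet_singleton k))
    (measurable_logRatio.comp measurable_snd) measurable_const

theorem hardEnv_switchAt_eq_withDensity (hε : |ε| < 1 / 2) (σ : ℕ → Option (Fin K)) (s t : ℕ)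
    (k j : Fin K) :
    (hardEnv a ε (switchAt σ s (some k)) t j : Measure ℝ) =
      (hardEnv a ε (switchAt σ s none) t j : Measure ℝ).withDensity fun x =>
        ENNReal.ofReal (Real.exp (if s ≤ t then armLogRatio a ε k (j, x) else 0)) := by
  have hone : ∀ μ : Measure ℝ, μ.withDensity (fun _ => 1) = μ := fun μ => withDensity_one
  rcases lt_or_ge t s with ht | ht
  · simp [hardEnv, switchAt, ht, ht.not_ge, hone]
  · rcases eq_or_ne j k with rfl | hj
    · simpa [hardEnv, switchAt, ht, ht.not_gt, armLogRatio] using twoPoint_eq_withDensity hε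
    · simp [hardEnv, switchAt, ht, ht.not_gt, armLogRatio, hj, hj.symm, hone]

theorem integrable_armLogRatio (σ : ℕ → Option (Fin K)) (t : ℕ) (k j : Fin K) :
    Integrable (fun x => armLogRatio a ε k (j, x)) (hardEnv a ε σ t j : Measure ℝ) :=
  integrable_twoPoint _

theorem integral_cumul_armLogRatio (σ : ℕ → Option (Fin K)) (s n : ℕ) (k : Fin K) :
    ∫ h : History K n, cumul s (fun _ => armLogRatio a ε k) h
        ∂(historyLaw (hardEnv a ε (switchAt σ s none)) ρ n) =
      (∑ t ∈ Finset.Ico s n, (armLaw (hardEnv a ε (switchAt σ s none)) ρ t).real {k}) *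
        ∫ x, logRatio a ε x ∂(twoPoint a 0 : Measure ℝ) := by
  rw [integral_cumul (fun _ => measurable_armLogRatio k)
    fun t _ _ j => integrable_armLogRatio _ t k j, Finset.sum_mul]
  refine Finset.sum_congr rfl fun t ht => ?_
  have hst : ¬ t < s := (Finset.mem_Ico.1 ht).1.not_gt
  rw [← integral_ite_eq]
  refine integral_congr_ae (ae_of_all _ fun j => ?_)
  by_cases hj : j = k <;> simp [hardEnv, switchAt, hst, armLogRatio, hj]

theorem sum_armLaw_switchAt_le (hε : |ε| ≤ 1 / 4) (σ : ℕ → Option (Fin K)) (s d : ℕ)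
    (k : Fin K) :
    ∑ t ∈ Finset.Ico s (s + d), (armLaw (hardEnv a ε (switchAt σ s (some k))) ρ t).real {k} ≤
      (1 + 32 * ε ^ 2 * d) *
        ∑ t ∈ Finset.Ico s (s + d), (armLaw (hardEnv a ε (switchAt σ s none)) ρ t).real {k} +
      d / 8 := by
  have hle := sum_armLaw_le_of_withDensity (ρ := ρ) (n := s + d)
    (fun _ => measurable_armLogRatio k)
    (fun t _ j => hardEnv_switchAt_eq_withDensity (a := a) (hε.trans_lt (by norm_num)) σ s t k j)
    (integrable_cumul (fun _ => measurable_armLogRatio k)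
      fun t _ _ j => integrable_armLogRatio _ t k j) k
  rw [integral_cumul_armLogRatio, Nat.add_sub_cancel_left] at hle
  set N := ∑ t ∈ Finset.Ico s (s + d), (armLaw (hardEnv a ε (switchAt σ s none)) ρ t).real {k}
  have : 0 ≤ N := Finset.sum_nonneg fun _ _ => measureReal_nonneg
  have hdN : 0 ≤ (d : ℝ) * N := by positivity
  linarith [mul_le_mul_of_nonneg_left (neg_sq_le_integral_logRatio (a := a) hε) hdN]

theorem exists_hard_arm (hK : 2 ≤ K) (hε : |ε| ≤ 1 / 4) (σ : ℕ → Option (Fin K)) (s d : ℕ)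
    (hd : 256 * ε ^ 2 * d ≤ K) :
    ∃ k, ∑ t ∈ Finset.Ico s (s + d), (armLaw (hardEnv a ε (switchAt σ s (some k))) ρ t).real {k} ≤
      3 / 4 * d := by
  have : Nonempty (Fin K) := ⟨⟨0, by omega⟩⟩
  have hK2 : (2 : ℝ) ≤ K := Nat.ofNat_le_cast.2 hK
  have htotal : ∑ k, ∑ t ∈ Finset.Ico s (s + d),
      (armLaw (hardEnv a ε (switchAt σ s none)) ρ t).real {k} = d := by
    rw [Finset.sum_comm]
    simp [sum_measureReal_singleton]
  obtain ⟨k, -, hk⟩ := Finset.exists_le_of_sum_le (s := (Finset.univ : Finset (Fin K)))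
    (f := fun k => ∑ t ∈ Finset.Ico s (s + d),
      (armLaw (hardEnv a ε (switchAt σ s (some k))) ρ t).real {k})
    (g := fun _ => 3 / 4 * (d : ℝ)) Finset.univ_nonempty <| by
      calc _ ≤ ∑ k, ((1 + 32 * ε ^ 2 * d) * ∑ t ∈ Finset.Ico s (s + d),
              (armLaw (hardEnv a ε (switchAt σ s none)) ρ t).real {k} + d / 8) :=
            Finset.sum_le_sum fun k _ => sum_armLaw_switchAt_le hε σ s d k
        _ = (1 + 32 * ε ^ 2 * d) * d + K * (d / 8) := by
            rw [Finset.sum_add_distrib, ← Finset.mul_sum, htotal, Fin.sum_const, nsmul_eq_mul]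
        _ ≤ (K / 2 + K / 8) * d + K * (d / 8) := by gcongr <;> linarith
        _ = ∑ _k : Fin K, 3 / 4 * (d : ℝ) := by
            rw [Fin.sum_const, nsmul_eq_mul]
            ring
  exact ⟨k, hk⟩

end HardEnv

/-! ### Batches of hard environments -/

section BatchEnv

variable {K L : ℕ} {ρ : Policy K} {a b ε V : ℝ}

/-- The hard environment whose best arm is constant on batches of `L` slots, equal to `σ q` on the
batch `{L * q, …, L * (q + 1) - 1}`. -/
noncomputable def batchEnv (a ε : ℝ) (L : ℕ) (σ : ℕ → Fin K) : Environment K :=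
  hardEnv a ε fun t => some (σ (t / L))

theorem batchEnv_update_of_lt (σ : ℕ → Fin K) {q t : ℕ} (k : Fin K) (ht : t < L * q) :
    batchEnv a ε L (Function.update σ q k) t = batchEnv a ε L σ t :=
  hardEnv_congr <| congrArg some <| Function.update_of_ne (Nat.div_lt_of_lt_mul ht).ne _ _

theorem batchEnv_update_of_lt_succ (σ : ℕ → Fin K) {q t : ℕ} (k : Fin K)
    (ht : t < L * (q + 1)) :
    batchEnv a ε L (Function.update σ q k) t =
      hardEnv a ε (switchAt (fun u => some (σ (u / L))) (L * q) (some k)) t := by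
  rcases lt_or_ge t (L * q) with h | h
  · rw [batchEnv_update_of_lt σ k h]
    exact hardEnv_congr (if_pos h).symm
  · have hq : t / L = q := Nat.div_eq_of_lt_le (by rwa [mul_comm]) (by rwa [mul_comm])
    refine hardEnv_congr ?_
    rw [hq, Function.update_self, switchAt, if_neg h.not_gt]

theorem sum_armLaw_batchEnv_update (σ : ℕ → Fin K) (q : ℕ) (k : Fin K) {d : ℕ} (hd : d ≤ L) :
    ∑ t ∈ Finset.range (L * q + d), (armLaw (batchEnv a ε L (Function.update σ q k)) ρ t).real
        {Function.update σ q k (t / L)} =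
      ∑ t ∈ Finset.range (L * q), (armLaw (batchEnv a ε L σ) ρ t).real {σ (t / L)} +
      ∑ t ∈ Finset.Ico (L * q) (L * q + d), (armLaw
        (hardEnv a ε (switchAt (fun u => some (σ (u / L))) (L * q) (some k))) ρ t).real {k} := by
  rw [← Finset.sum_range_add_sum_Ico _ (Nat.le_add_right _ d)]
  refine congrArg₂ _ (Finset.sum_congr rfl fun t ht => ?_) (Finset.sum_congr rfl fun t ht => ?_)
  · have htq := Finset.mem_range.1 ht
    rw [armLaw_congr fun u hu => batchEnv_update_of_lt σ k (hu.trans htq),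
      Function.update_of_ne (Nat.div_lt_of_lt_mul htq).ne]
  · obtain ⟨hqt, htd⟩ := Finset.mem_Ico.1 ht
    have htq : t < L * (q + 1) := htd.trans_le (by rw [mul_add_one]; omega)
    have hq : t / L = q := Nat.div_eq_of_lt_le (by rwa [mul_comm]) (by rwa [mul_comm])
    rw [armLaw_congr fun u hu => batchEnv_update_of_lt_succ σ k (hu.trans htq), hq,
      Function.update_self]

theorem exists_hard_batches (hK : 2 ≤ K) (hε : |ε| ≤ 1 / 4) (hL : 256 * ε ^ 2 * L ≤ K)
    {q T : ℕ} (hT : T ≤ L * q) :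
    ∃ σ : ℕ → Fin K, ∑ t ∈ Finset.range T,
      (armLaw (batchEnv a ε L σ) ρ t).real {σ (t / L)} ≤ 3 / 4 * T := by
  induction q generalizing T with
  | zero =>
    obtain rfl : T = 0 := by omega
    exact ⟨fun _ => ⟨0, by omega⟩, by simp⟩
  | succ q ih =>
    rcases le_or_gt T (L * q) with hTq | hTq
    · exact ih hTq
    obtain ⟨σ, hσ⟩ := ih le_rfl
    obtain ⟨d, rfl⟩ := Nat.exists_eq_add_of_le hTq.le
    have hd : d ≤ L := by rw [mul_add_one] at hT; omega
    have hdK : 256 * ε ^ 2 * d ≤ K :=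
      (mul_le_mul_of_nonneg_left (Nat.cast_le.2 hd) (by positivity)).trans hL
    obtain ⟨k, hk⟩ := exists_hard_arm (ρ := ρ) (a := a) hK hε (fun t => some (σ (t / L)))
      (L * q) d hdK
    refine ⟨Function.update σ q k, ?_⟩
    rw [sum_armLaw_batchEnv_update σ q k hd]
    push_cast at hσ ⊢
    linarith

theorem drift_batchEnv_le (h0 : 0 ≤ ε) (h1 : ε ≤ 1 / 2) (σ : ℕ → Fin K) (t : ℕ) :
    drift (batchEnv a ε L σ) t ≤ ε * (((t + 1) / L : ℕ) - (t / L : ℕ)) := by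
  have hmono : t / L ≤ (t + 1) / L := Nat.div_le_div_right t.le_succ
  have hmean := mean_hardEnv (a := a) ((abs_of_nonneg h0).trans_le h1) fun t => some (σ (t / L))
  refine Real.iSup_le (fun k => ?_) (mul_nonneg h0 (sub_nonneg.2 (Nat.cast_le.2 hmono)))
  rw [batchEnv, hmean, hmean]
  rcases hmono.eq_or_lt with heq | hlt
  · simp [heq]
  · have hjump : (1 : ℝ) ≤ ((t + 1) / L : ℕ) - (t / L : ℕ) := by
      rw [le_sub_iff_add_le']
      exact_mod_cast hlt
    refine le_trans ?_ (le_mul_of_one_le_right h0 hjump)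
    rw [abs_le]
    constructor <;> split_ifs <;> linarith

theorem variation_batchEnv_le (h0 : 0 ≤ ε) (h1 : ε ≤ 1 / 2) (σ : ℕ → Fin K) (T : ℕ) :
    variation (batchEnv a ε L σ) T ≤ ε * ((T - 1) / L : ℕ) := by
  calc variation (batchEnv a ε L σ) T
      ≤ ∑ t ∈ Finset.range (T - 1), ε * (((t + 1) / L : ℕ) - (t / L : ℕ)) :=
        Finset.sum_le_sum fun t _ => drift_batchEnv_le h0 h1 σ t
    _ = ε * ((T - 1) / L : ℕ) := by
        rw [← Finset.mul_sum, Finset.sum_range_sub fun t => ((t / L : ℕ) : ℝ)]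
        simp

theorem regret_batchEnv (h0 : 0 ≤ ε) (h1 : ε ≤ 1 / 2) (σ : ℕ → Fin K) (T : ℕ) :
    regret (batchEnv a ε L σ) ρ T = ε * (T - ∑ t ∈ Finset.range T,
      (armLaw (batchEnv a ε L σ) ρ t).real {σ (t / L)}) := by
  rw [batchEnv, (isSubGaussianEnv_hardEnv h0 h1 le_rfl _ T).regret_eq_sum]
  simp only [slotRegret_hardEnv (σ := fun t => some (σ (t / L))) h0 h1 rfl, ← Finset.mul_sum,
    Finset.sum_sub_distrib, Finset.sum_const, Finset.card_range, nsmul_eq_mul, mul_one]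

theorem exists_mem_envClass_le_regret (hK : 2 ≤ K) (h0 : 0 ≤ ε) (h1 : ε ≤ 1 / 4) (hb : ε ≤ b)
    (hL : 0 < L) (hLK : 256 * ε ^ 2 * L ≤ K) {T : ℕ} (hV : ε * ((T - 1) / L : ℕ) ≤ V)
    (ρ : Policy K) : ∃ E ∈ envClass K a b V T, ε * T / 4 ≤ regret E ρ T := by
  obtain ⟨σ, hσ⟩ := exists_hard_batches (ρ := ρ) (a := a) hK ((abs_of_nonneg h0).trans_le h1) hLK
    (Nat.le_mul_of_pos_left T hL)
  have h2 : ε ≤ 1 / 2 := by linarith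
  refine ⟨batchEnv a ε L σ, ⟨isSubGaussianEnv_hardEnv h0 h2 hb _ T,
    (variation_batchEnv_le h0 h2 σ T).trans hV⟩, ?_⟩
  rw [regret_batchEnv h0 h2]
  linarith [mul_le_mul_of_nonneg_left hσ h0]

end BatchEnv

section LowerBound

variable {K T : ℕ} {b V : ℝ}

theorem le_idealPeriod (hV : 0 < V) (hVT : V ≤ (T : ℝ) / K) : K ≤ idealPeriod K T V := by
  rcases K.eq_zero_or_pos with rfl | hK
  · simp [idealPeriod]
  have hK0 : (0 : ℝ) < K := Nat.cast_pos.2 hK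
  have hKT : (K : ℝ) ≤ T / V := (le_div_comm₀ hV hK0).1 hVT
  calc (K : ℝ) = (K : ℝ) ^ (1 / 3 : ℝ) * (K : ℝ) ^ (2 / 3 : ℝ) := by
        rw [← Real.rpow_add hK0]
        norm_num
    _ ≤ idealPeriod K T V := by unfold idealPeriod; gcongr

theorem sq_sqrt_div_idealPeriod_mul_restartPeriod_le (hx : 1 ≤ idealPeriod K T V) :
    √(K / idealPeriod K T V) ^ 2 * restartPeriod K T V ≤ 2 * K := by
  have hx0 : 0 < idealPeriod K T V := zero_lt_one.trans_le hx
  rw [Real.sq_sqrt (by positivity), div_mul_eq_mul_div, div_le_iff₀ hx0]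
  linarith [mul_le_mul_of_nonneg_left (restartPeriod_le_two_mul hx) K.cast_nonneg]

theorem sqrt_div_idealPeriod_mul_div_restartPeriod_le (hK : 0 < K) (hT : 0 < T) (hV : 0 < V) :
    √(K / idealPeriod K T V) * ((T - 1) / restartPeriod K T V : ℕ) ≤ V := by
  have hx : 0 < idealPeriod K T V := idealPeriod_pos hK hT hV
  have hbatches : (((T - 1) / restartPeriod K T V : ℕ) : ℝ) ≤ T / idealPeriod K T V := by
    refine Nat.cast_div_le.trans ?_
    gcongr
    · exact Nat.sub_le _ _
    · exact Nat.le_ceil _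
  calc _ ≤ √(K / idealPeriod K T V) * (T / idealPeriod K T V) := by gcongr
    _ = T * √(K / idealPeriod K T V) / idealPeriod K T V := by ring
    _ = V := by rw [mul_sqrt_div_idealPeriod hK hT hV, ← idealPeriod_mul hV,
        mul_div_cancel_left₀ _ hx.ne']

theorem exists_mem_envClass_rate_le_regret (a : ℝ) (hK : 2 ≤ K) (hV : 0 < V)
    (hVT : V ≤ (T : ℝ) / K) (hb : 0 < b) (ρ : Policy K) :
    ∃ E ∈ envClass K a b V T, min b (1 / 32) / 4 * rate K T V ≤ regret E ρ T := by
  have hK0 : 0 < K := by omega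
  have hT : 0 < T := by
    rw [Nat.pos_iff_ne_zero]
    rintro rfl
    simp only [CharP.cast_eq_zero, zero_div] at hVT
    linarith
  have hxK : K ≤ idealPeriod K T V := le_idealPeriod hV hVT
  have hx1 : 1 ≤ idealPeriod K T V := (Nat.one_le_cast.2 hK0).trans hxK
  have hrate := mul_sqrt_div_idealPeriod hK0 hT hV
  have hsq := sq_sqrt_div_idealPeriod_mul_restartPeriod_le hx1
  have hvar := sqrt_div_idealPeriod_mul_div_restartPeriod_le hK0 hT hV
  have hδ1 : √(K / idealPeriod K T V) ≤ 1 :=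
    Real.sqrt_le_one.2 (div_le_one_of_le₀ hxK (zero_le_one.trans hx1))
  have hδ0 := Real.sqrt_nonneg (K / idealPeriod K T V)
  set δ := √(K / idealPeriod K T V)
  obtain ⟨c, hc⟩ : ∃ c, c = min b (1 / 32) := ⟨_, rfl⟩
  have hc0 : 0 < c := hc ▸ by positivity
  have hc32 : c ≤ 1 / 32 := hc ▸ min_le_right _ _
  have hcδ : c * δ ≤ c := mul_le_of_le_one_right hc0.le hδ1
  have hhard : 256 * (c * δ) ^ 2 * restartPeriod K T V ≤ K := by
    calc 256 * (c * δ) ^ 2 * (restartPeriod K T V : ℝ)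
      _ = 256 * c ^ 2 * (δ ^ 2 * restartPeriod K T V) := by ring
      _ ≤ 256 * (1 / 32) ^ 2 * (2 * (K : ℝ)) := by gcongr
      _ ≤ (K : ℝ) := by linarith [K.cast_nonneg (α := ℝ)]
  have hbudget : c * δ * ((T - 1) / restartPeriod K T V : ℕ) ≤ V := by
    rw [mul_assoc]
    exact (mul_le_mul (hc32.trans (by norm_num)) hvar (by positivity) zero_le_one).trans_eq
      (one_mul V)
  obtain ⟨E, hE, hreg⟩ := exists_mem_envClass_le_regret (a := a) hK (by positivity)
    (by linarith : c * δ ≤ 1 / 4) (hcδ.trans (hc ▸ min_le_left _ _))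
    (Nat.ceil_pos.2 (zero_lt_one.trans_le hx1)) hhard hbudget ρ
  refine ⟨E, hE, le_of_eq_of_le ?_ hreg⟩
  rw [← hrate, ← hc]
  ring

end LowerBound

end Bandit

theorem theorem1_general (b : ℝ) (hb : 0 < b) :
    (∃ C : ℝ, 0 < C ∧ ∀ (a : ℝ) (K T : ℕ) (V : ℝ), 0 < K → 0 < T → 0 < V →
      Bandit.restartPeriod K T V ≤ T →
      ∀ ρ : Bandit.Policy K, Bandit.IsResettingMoss ρ (Bandit.restartPeriod K T V) →
        Bandit.worstCaseRegret ρ a b V T ≤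
          ((C * ((K : ℝ) * V) ^ (1 / 3 : ℝ) * (T : ℝ) ^ (2 / 3 : ℝ) : ℝ) : EReal)) ∧
    (∃ c : ℝ, 0 < c ∧ ∀ (a : ℝ) (K T : ℕ) (V : ℝ), 2 ≤ K → 0 < V → V ≤ (T : ℝ) / K →
      ((c * ((K : ℝ) * V) ^ (1 / 3 : ℝ) * (T : ℝ) ^ (2 / 3 : ℝ) : ℝ) : EReal) ≤
        Bandit.minimaxRegret K a b V T) := by
  refine ⟨⟨2 * b + 128, by positivity, fun a K T V hK hT hV hτT ρ hρ => ?_⟩,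
    ⟨min b (1 / 32) / 4, by positivity, fun a K T V hK hV hVT => ?_⟩⟩
  · refine iSup₂_le fun E hE => EReal.coe_le_coe_iff.2 ?_
    rw [mul_assoc]
    exact Bandit.regret_le_rate hK hT hV hb.le hτT hρ hE
  · refine le_iInf fun ρ => ?_
    obtain ⟨E, hE, hreg⟩ := Bandit.exists_mem_envClass_rate_le_regret a hK hV hVT hb ρ
    rw [mul_assoc]
    exact (EReal.coe_le_coe_iff.2 hreg).trans
      (le_iSup₂ (f := fun E (_ : E ∈ Bandit.envClass K a b V T) =>
        (Bandit.regret E ρ T : EReal)) E hE)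

theorem theorem1 (b : ℝ) (hb : 0 < b) :
    (∃ C : ℝ, 0 < C ∧ ∀ (a : ℝ) (K T : ℕ) (V : ℝ), 0 < K → 0 < T → 0 < V →
      Bandit.restartPeriod K T V ≤ T →
      ∀ ρ : Bandit.Policy K, Bandit.IsResettingMoss ρ (Bandit.restartPeriod K T V) →
        Bandit.worstCaseRegret ρ a b V T ≤
          ((C * ((K : ℝ) * V) ^ (1 / 3 : ℝ) * (T : ℝ) ^ (2 / 3 : ℝ) : ℝ) : EReal)) ∧
    (∃ c : ℝ, 0 < c ∧ ∀ (a : ℝ) (K T : ℕ) (V : ℝ), 2 ≤ K → 0 < T →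
      1 / (K : ℝ) ≤ V → V ≤ (T : ℝ) / K →
        ((c * ((K : ℝ) * V) ^ (1 / 3 : ℝ) * (T : ℝ) ^ (2 / 3 : ℝ) : ℝ) : EReal) ≤
          Bandit.minimaxRegret K a b V T) := by
  obtain ⟨hupper, c, hc, hlower⟩ := theorem1_general b hb
  exact ⟨hupper, c, hc, fun a K T V hK _ hKV =>
    hlower a K T V hK (lt_of_lt_of_le (by positivity) hKV)⟩
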